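/- **Setting.** Let $\mathcal L_{\mathbb N}$ be a first-order language of arithmetic with logical symbols $\neg,\vee,\wedge,\forall,\exists,=$ (with $\varphi\to\psi:=\neg\varphi\vee\psi$), containing $0,S,+,\cdot$ and finitely many further function symbols for primitive recursive functions: a pairing function, the syntactic operations $\dot{=},\dot\neg,\dot\vee,\dot\wedge,\dot\forall,\dot\exists$ on Gödel codes, the function $\mathrm{num}$ ($n\mapsto$ code of the numeral $\bar n$), substitution $x(t/v)$ (which returns a number that is not a code unless $x$ codes a term or formula, $t$ a term and $v$ a variable), and some auxiliary ones (characteristic functions of "term", "formula", "free in", "free for", list membership, and the formation of quantifier prefixes). Put $\mathcal L_{\mathrm{Tr}}=\mathcal L_{\mathbb N}\cup\{\mathrm{Tr}\}$, and fix a Gödel coding $\#$ of its expressions. $\mathrm{CT}(x)$, $\mathrm{Sent}(x)$ and $\mathrm{Ax}_{\mathrm{PAT}}(x)$ are arithmetical formulas expressing that $x$ codes a closed term, an $\mathcal L_{\mathrm{Tr}}$-sentence, and a sentence that is an axiom of $\mathrm{PAT}$ or an axiom of classical first-order logic; $x^\circ$ is the value of the closed term coded by $x$; $x\dot{\neq}y$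 is $\dot\neg(x\dot{=}y)$ and $x\dot\to y$ is $(\dot\neg x)\dot\vee y$; $\ulcorner\varphi(\dot x)\urcorner$ is $\ulcorner\varphi(v)\urcorner(\mathrm{num}(x)/\ulcorner v\urcorner)$. $\mathrm{PAT}$ is Peano arithmetic with the defining equations of the additional function symbols and with (universal closures of) induction for all $\mathcal L_{\mathrm{Tr}}$-formulas. $\mathrm{VFM}$ is $\mathrm{PAT}$ plus the universal closures of * (VF1) $\mathrm{CT}(x)\wedge\mathrm{CT}(y)\to[(\mathrm{Tr}(x\dot{=}y)\leftrightarrow x^\circ=y^\circ)\wedge(\mathrm{Tr}(x\dot{\neq}y)\leftrightarrow x^\circ\neq y^\circ)]$ * (VF2) $\mathrm{Ax}_{\mathrm{PAT}}(x)\to\mathrm{Tr}(x)$ * (VF3) $\forall z\,\mathrm{Tr}(x(\mathrm{num}(z)/v))\to\mathrm{Tr}(\dot\forall v\,x)$ * (VF4) $\mathrm{Tr}(x)\leftrightarrow\mathrm{Tr}(\ulcorner\mathrm{Tr}(\dot x)\urcorner)$ * (VF5) $\mathrm{Sent}(x)\to(\mathrm{Tr}(\dot\neg\ulcorner\mathrm{Tr}(\dot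 x)\urcorner)\leftrightarrow\mathrm{Tr}(\dot\neg x))$ * (VF6) $\mathrm{Tr}(x\dot\to y)\to(\mathrm{Tr}(x)\to\mathrm{Tr}(y))$ * (VF7) $\mathrm{Tr}(\ulcorner\mathrm{Sent}(\dot x)\to(\neg\mathrm{Tr}(\dot x)\leftrightarrow\mathrm{Tr}(\dot\neg\dot x))\urcorner)$ * (VF8) $\mathrm{Tr}(\ulcorner\mathrm{Tr}(\dot x)\to\mathrm{Sent}(\dot x)\urcorner)$ and $\mathrm{VFM}^-$ is the same theory with VF4 weakened to $\mathrm{Tr}(x)\to\mathrm{Tr}(\ulcorner\mathrm{Tr}(\dot x)\urcorner)$. A set of sentences is *deductively consistent* if no contradiction is derivable from it in classical first-order logic with equality. A set $X'$ of codes of $\mathcal L_{\mathrm{Tr}}$-sentences is *maximally consistent*, $\mathrm{MCX}(X')$, if it is deductively consistent and has no proper deductively consistent extension by codes of $\mathcal L_{\mathrm{Tr}}$-sentences. For a sentence $\varphi$ put $X\models_{\mathrm{mc}}\varphi$ iff $(\mathbb N,X')\models\varphi$ classically for all $X'\supseteq X$ with $\mathrm{MCX}(X')$, and $\mathcal J_{\mathrm{mc}}(X)=\{\#\varphi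 : \varphi \text{ is a sentence and } X\models_{\mathrm{mc}}\varphi\}$. **Proposition.** Let $X\subseteq\mathbb N$ be consistent, in the sense that there is no sentence $\varphi$ with $\#\varphi\in X$ and $\#\neg\varphi\in X$ (in particular this holds if $X$ is deductively consistent), and let $X=\mathcal J_{\mathrm{mc}}(X)$. Then $(\mathbb N,X)\models\mathrm{VFM}$, where $\mathrm{Tr}$ is interpreted by $X$. Moreover, the theories $\mathrm{VFM}$ and $\mathrm{VFM}^-$ are deductively consistent. -/

import Mathlib

namespace SupervalTruth

/-! ### The language with a truth predicate -/

/-- The finitely many function symbols of the arithmetical base language, indexed by their arity: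
zero, successor, sum and product, and symbols for the following primitive recursive functions.
* `pr`: the pairing function of numbers;
* `dEq`, `dNeg`, `dOr`, `dAnd`, `dAll`, `dEx`: from codes of expressions to the code of the
  equation, negation, disjunction, conjunction, universal and existential quantification;
* `num`: from `n` to the code of the numeral of `n`;
* `tm`, `fm`: characteristic functions of the codes of terms and of formulas;
* `fv`: characteristic function of the relation "the variable `v` is free in the expression `x`";
* `sub`: from `x, t, v` to the code of the result `x(t/v)` of substituting `t` for `v` in `x`;
* `ff`: characteristic function of the relation "`t` is free for `v` in the formula `x`";
* `gen`: from a list of variables and a formula to the formula with that quantifier prefix;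
* `mem`: characteristic function of membership in the finite list coded by a number. -/
inductive Fn : ℕ → Type
  | zero : Fn 0
  | succ : Fn 1
  | plus : Fn 2
  | times : Fn 2
  | pr : Fn 2
  | dEq : Fn 2
  | dNeg : Fn 1
  | dOr : Fn 2
  | dAnd : Fn 2
  | dAll : Fn 2
  | dEx : Fn 2
  | num : Fn 1
  | tm : Fn 1
  | fm : Fn 1
  | fv : Fn 2
  | sub : Fn 3
  | ff : Fn 3
  | gen : Fn 2
  | mem : Fn 2

/-- All function symbols. -/
def Fn.all : List (Σ k, Fn k) :=
  [⟨0, .zero⟩, ⟨1, .succ⟩, ⟨2, .plus⟩, ⟨2, .times⟩, ⟨2, .pr⟩, ⟨2, .dEq⟩, ⟨1, .dNeg⟩, ⟨2, .dOr⟩,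
   ⟨2, .dAnd⟩, ⟨2, .dAll⟩, ⟨2, .dEx⟩, ⟨1, .num⟩, ⟨1, .tm⟩, ⟨1, .fm⟩, ⟨2, .fv⟩, ⟨3, .sub⟩,
   ⟨3, .ff⟩, ⟨2, .gen⟩, ⟨2, .mem⟩]

/-- Terms, with variables `v₀, v₁, …`. -/
inductive Tm : Type
  | var (n : ℕ) : Tm
  | app {k : ℕ} (f : Fn k) (ts : Fin k → Tm) : Tm

/-- Formulas; `tr t` is the atomic formula `Tr(t)`. -/
inductive Fm : Type
  | eq (s t : Tm) : Fm
  | tr (t : Tm) : Fm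
  | neg (φ : Fm) : Fm
  | or (φ ψ : Fm) : Fm
  | and (φ ψ : Fm) : Fm
  | all (n : ℕ) (φ : Fm) : Fm
  | ex (n : ℕ) (φ : Fm) : Fm

namespace Fm

def imp (φ ψ : Fm) : Fm := (neg φ).or ψ

def iff (φ ψ : Fm) : Fm := (φ.imp ψ).and (ψ.imp φ)

/-- `φ` with the quantifier prefix `∀v` for `v` in the list. -/
def alls (vs : List ℕ) (φ : Fm) : Fm := vs.foldr all φ

/-- `φ` with the quantifier prefix `∃v` for `v` in the list. -/
def exs (vs : List ℕ) (φ : Fm) : Fm := vs.foldr ex φ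

end Fm

/-- `t.Occ n`: the variable `vₙ` occurs in `t`. -/
def Tm.Occ (n : ℕ) : Tm → Prop
  | .var m => m = n
  | .app _ ts => ∃ i, (ts i).Occ n

/-- `φ.Free n`: the variable `vₙ` is free in `φ`. -/
def Fm.Free (n : ℕ) : Fm → Prop
  | .eq s t => s.Occ n ∨ t.Occ n
  | .tr t => t.Occ n
  | .neg φ => φ.Free n
  | .or φ ψ => φ.Free n ∨ ψ.Free n
  | .and φ ψ => φ.Free n ∨ ψ.Free n
  | .all m φ => m ≠ n ∧ φ.Free n
  | .ex m φ => m ≠ n ∧ φ.Free n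

def Fm.IsSentence (φ : Fm) : Prop := ∀ n, ¬ φ.Free n

/-- `u.subst n t` is `u(t/vₙ)`. -/
def Tm.subst : Tm → ℕ → Tm → Tm
  | .var m, n, t => if m = n then t else .var m
  | .app f ts, n, t => .app f fun i => (ts i).subst n t

/-- `φ.subst n t` is `φ(t/vₙ)`: all free occurrences of `vₙ` are replaced by `t`. -/
def Fm.subst (n : ℕ) (t : Tm) : Fm → Fm
  | .eq r s => .eq (r.subst n t) (s.subst n t)
  | .tr s => .tr (s.subst n t)
  | .neg φ => .neg (φ.subst n t)
  | .or φ ψ => .or (φ.subst n t) (ψ.subst n t)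
  | .and φ ψ => .and (φ.subst n t) (ψ.subst n t)
  | .all m φ => .all m (if m = n then φ else φ.subst n t)
  | .ex m φ => .ex m (if m = n then φ else φ.subst n t)

/-- `φ.FreeFor n t`: the term `t` is free for `vₙ` in `φ` (no variable is captured). -/
def Fm.FreeFor (n : ℕ) (t : Tm) : Fm → Prop
  | .eq _ _ => True
  | .tr _ => True
  | .neg φ => φ.FreeFor n t
  | .or φ ψ => φ.FreeFor n t ∧ ψ.FreeFor n t
  | .and φ ψ => φ.FreeFor n t ∧ ψ.FreeFor n t
  | .all m φ => ¬ (Fm.all m φ).Free n ∨ (¬ t.Occ m ∧ φ.FreeFor n t)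
  | .ex m φ => ¬ (Fm.ex m φ).Free n ∨ (¬ t.Occ m ∧ φ.FreeFor n t)

/-! ### First-order derivability and consistency -/

/-- A Hilbert style axiomatization of classical first-order logic with equality. -/
inductive LogAx : Fm → Prop
  | k (a b : Fm) : LogAx (a.imp (b.imp a))
  | s (a b c : Fm) : LogAx ((a.imp (b.imp c)).imp ((a.imp b).imp (a.imp c)))
  | contra (a b : Fm) : LogAx ((a.neg.imp b.neg).imp (b.imp a))
  | orLeft (a b : Fm) : LogAx (a.imp (a.or b))
  | orRight (a b : Fm) : LogAx (b.imp (a.or b))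
  | orElim (a b c : Fm) : LogAx ((a.imp c).imp ((b.imp c).imp ((a.or b).imp c)))
  | andLeft (a b : Fm) : LogAx ((a.and b).imp a)
  | andRight (a b : Fm) : LogAx ((a.and b).imp b)
  | andIntro (a b : Fm) : LogAx (a.imp (b.imp (a.and b)))
  | allDist (n : ℕ) (a b : Fm) : LogAx ((Fm.all n (a.imp b)).imp ((Fm.all n a).imp (Fm.all n b)))
  | allVac (n : ℕ) (a : Fm) (h : ¬ a.Free n) : LogAx (a.imp (Fm.all n a))
  | allInst (n : ℕ) (a : Fm) (t : Tm) (h : a.FreeFor n t) : LogAx ((Fm.all n a).imp (a.subst n t))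
  | exIntro (n : ℕ) (a : Fm) (t : Tm) (h : a.FreeFor n t) : LogAx ((a.subst n t).imp (Fm.ex n a))
  | exElim (n : ℕ) (a b : Fm) (h : ¬ b.Free n) :
      LogAx ((Fm.all n (a.imp b)).imp ((Fm.ex n a).imp b))
  | eqRefl (t : Tm) : LogAx (Fm.eq t t)
  | eqSubst (n : ℕ) (a : Fm) (s t : Tm) (hs : a.FreeFor n s) (ht : a.FreeFor n t) :
      LogAx ((Fm.eq s t).imp ((a.subst n s).imp (a.subst n t)))

/-- The logical axioms: all generalizations of the above. Modus ponens is then the only rule. -/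
def IsLogicalAxiom (φ : Fm) : Prop := ∃ vs ψ, LogAx ψ ∧ φ = Fm.alls vs ψ

/-- `Proves T φ`: the formula `φ` is derivable in first-order logic from the set `T`. -/
inductive Proves (T : Set Fm) : Fm → Prop
  | hyp {φ : Fm} : φ ∈ T → Proves T φ
  | logic {φ : Fm} : IsLogicalAxiom φ → Proves T φ
  | mp {φ ψ : Fm} : Proves T (φ.imp ψ) → Proves T φ → Proves T ψ

/-- A set of sentences is consistent if no contradiction is derivable from it. -/
def Consistent (T : Set Fm) : Prop := ¬ ∃ φ, Proves T φ ∧ Proves T φ.neg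

/-! ### Gödel coding -/

/-- The tag of a function symbol in the coding. -/
def Fn.tag : {k : ℕ} → Fn k → ℕ
  | _, .zero => 10
  | _, .succ => 11
  | _, .plus => 12
  | _, .times => 13
  | _, .pr => 14
  | _, .dEq => 15
  | _, .dNeg => 16
  | _, .dOr => 17
  | _, .dAnd => 18
  | _, .dAll => 19
  | _, .dEx => 20
  | _, .num => 21
  | _, .tm => 22
  | _, .fm => 23
  | _, .fv => 24
  | _, .sub => 25
  | _, .ff => 26
  | _, .gen => 27
  | _, .mem => 28

/-- The code of an expression with a given main symbol and given codes of its parts. -/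
def node (tag : ℕ) (xs : List ℕ) : ℕ := Nat.pair tag (xs.foldr Nat.pair 0)

def varCode (n : ℕ) : ℕ := Nat.pair 1 n

def Tm.code : Tm → ℕ
  | .var n => varCode n
  | .app f ts => node f.tag (List.ofFn fun i => (ts i).code)

def Fm.code : Fm → ℕ
  | .eq s t => node 2 [s.code, t.code]
  | .tr t => node 3 [t.code]
  | .neg φ => node 4 [φ.code]
  | .or φ ψ => node 5 [φ.code, ψ.code]
  | .and φ ψ => node 6 [φ.code, ψ.code]
  | .all n φ => node 7 [varCode n, φ.code]
  | .ex n φ => node 8 [varCode n, φ.code]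

/-- The numeral of a number. -/
def numeral : ℕ → Tm
  | 0 => .app .zero ![]
  | n + 1 => .app .succ ![numeral n]

/-- The substitution function on codes: the code of `x(t/v)` if `x` is the code of a term or of a
formula, `t` is the code of a term and `v` the code of a variable; and `0`, which is not a code,
otherwise. -/
noncomputable def subCode (x t v : ℕ) : ℕ :=
  match Function.partialInv Tm.code t, Function.partialInv Tm.code v with
  | some s, some (.var n) =>
    match Function.partialInv Tm.code x, Function.partialInv Fm.code x with
    | some u, _ => (u.subst n s).code
    | none, some φ => (φ.subst n s).code
    | none, none => 0
  | _, _ => 0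

/-! ### The standard model -/

open Classical in
/-- The intended interpretations of the function symbols. Lists are coded as in
`Encodable (List ℕ)`: the code of `[]` is `0` and the code of `h :: l` is `⟨h, code of l⟩ + 1`. -/
noncomputable def Fn.interp : {k : ℕ} → Fn k → (Fin k → ℕ) → ℕ
  | _, .zero, _ => 0
  | _, .succ, a => a 0 + 1
  | _, .plus, a => a 0 + a 1
  | _, .times, a => a 0 * a 1
  | _, .pr, a => Nat.pair (a 0) (a 1)
  | _, .dEq, a => node 2 [a 0, a 1]
  | _, .dNeg, a => node 4 [a 0]
  | _, .dOr, a => node 5 [a 0, a 1]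
  | _, .dAnd, a => node 6 [a 0, a 1]
  | _, .dAll, a => node 7 [a 0, a 1]
  | _, .dEx, a => node 8 [a 0, a 1]
  | _, .num, a => (numeral (a 0)).code
  | _, .tm, a => if ∃ t : Tm, t.code = a 0 then 1 else 0
  | _, .fm, a => if ∃ φ : Fm, φ.code = a 0 then 1 else 0
  | _, .fv, a =>
    if ∃ n, varCode n = a 1 ∧
      ((∃ t : Tm, t.code = a 0 ∧ t.Occ n) ∨ ∃ φ : Fm, φ.code = a 0 ∧ φ.Free n) then 1 else 0
  | _, .sub, a => subCode (a 0) (a 1) (a 2)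
  | _, .ff, a =>
    if ∃ (φ : Fm) (t : Tm) (n : ℕ),
      φ.code = a 0 ∧ t.code = a 1 ∧ varCode n = a 2 ∧ φ.FreeFor n t then 1 else 0
  | _, .gen, a => (Denumerable.ofNat (List ℕ) (a 0)).foldr (fun v x => node 7 [v, x]) (a 1)
  | _, .mem, a => if a 0 ∈ Denumerable.ofNat (List ℕ) (a 1) then 1 else 0

/-- The value of a term in the standard model under an assignment. -/
noncomputable def Tm.val (e : ℕ → ℕ) : Tm → ℕ
  | .var n => e n
  | .app f ts => f.interp fun i => (ts i).val e

/-- Classical satisfaction in `(ℕ, X)`, where `X` interprets the truth predicate. -/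
def Fm.Sat (X : Set ℕ) : (ℕ → ℕ) → Fm → Prop
  | e, .eq s t => s.val e = t.val e
  | e, .tr t => t.val e ∈ X
  | e, .neg φ => ¬ φ.Sat X e
  | e, .or φ ψ => φ.Sat X e ∨ ψ.Sat X e
  | e, .and φ ψ => φ.Sat X e ∧ ψ.Sat X e
  | e, .all n φ => ∀ m, φ.Sat X (Function.update e n m)
  | e, .ex n φ => ∃ m, φ.Sat X (Function.update e n m)

/-- `(ℕ, X) ⊨ φ`. -/
def Models (X : Set ℕ) (φ : Fm) : Prop := ∀ e, φ.Sat X e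

/-! ### Supervaluation over maximally consistent extensions -/

/-- The set of codes of sentences. -/
def sentCodes : Set ℕ := {x | ∃ φ : Fm, φ.IsSentence ∧ φ.code = x}

/-- The antiextension `X⁻`: the codes of the sentences whose negation is in `X`. -/
def antiext (X : Set ℕ) : Set ℕ :=
  {x | ∃ φ : Fm, φ.IsSentence ∧ φ.code = x ∧ φ.neg.code ∈ X}

/-- The set of sentences with codes in `X`. -/
def theoryOf (X : Set ℕ) : Set Fm := {φ | φ.IsSentence ∧ φ.code ∈ X}

/-- `X` is a maximally consistent set of codes of sentences. -/
def MCX (X : Set ℕ) : Prop :=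
  X ⊆ sentCodes ∧ Consistent (theoryOf X) ∧
    ∀ Y, Y ⊆ sentCodes → Consistent (theoryOf Y) → X ⊆ Y → Y = X

/-- The supervaluational satisfaction relation `X ⊨_mc φ`. -/
def SatMC (X : Set ℕ) (φ : Fm) : Prop := ∀ X', X ⊆ X' → MCX X' → Models X' φ

/-- The Kripke jump for the scheme MC. -/
def jumpMC (S : Set ℕ) : Set ℕ := {x | ∃ φ : Fm, φ.IsSentence ∧ φ.code = x ∧ SatMC S φ}

/-! ### Terms and formulas of the language used in the axioms -/

def V (n : ℕ) : Tm := .var n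
def zeroT : Tm := .app .zero ![]
def succT (s : Tm) : Tm := .app .succ ![s]
def oneT : Tm := succT zeroT
def plusT (s t : Tm) : Tm := .app .plus ![s, t]
def timesT (s t : Tm) : Tm := .app .times ![s, t]
def prT (s t : Tm) : Tm := .app .pr ![s, t]
def dEqT (s t : Tm) : Tm := .app .dEq ![s, t]
def dNegT (s : Tm) : Tm := .app .dNeg ![s]
def dOrT (s t : Tm) : Tm := .app .dOr ![s, t]
def dAndT (s t : Tm) : Tm := .app .dAnd ![s, t]
def dImpT (s t : Tm) : Tm := dOrT (dNegT s) t
def dAllT (s t : Tm) : Tm := .app .dAll ![s, t]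
def dExT (s t : Tm) : Tm := .app .dEx ![s, t]
def numT (s : Tm) : Tm := .app .num ![s]
def tmT (s : Tm) : Tm := .app .tm ![s]
def fmT (s : Tm) : Tm := .app .fm ![s]
def fvT (s t : Tm) : Tm := .app .fv ![s, t]
def subT (s t r : Tm) : Tm := .app .sub ![s, t, r]
def ffT (s t r : Tm) : Tm := .app .ff ![s, t, r]
def genT (s t : Tm) : Tm := .app .gen ![s, t]
def memT (s t : Tm) : Tm := .app .mem ![s, t]

/-- The object-language term for `node`. -/
def nodeT (tag : ℕ) (ts : List Tm) : Tm := prT (numeral tag) (ts.foldr prT zeroT)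

def prodT (ts : List Tm) : Tm := ts.foldr timesT oneT

def botF : Fm := .eq zeroT oneT

def topF : Fm := .eq zeroT zeroT

def disjF (φs : List Fm) : Fm := φs.foldr .or botF

def conjF (φs : List Fm) : Fm := φs.foldr .and topF

/- The bound variables of the following formulas have indices that do not occur in the terms
to which these formulas are applied below. -/

/-- `s < t`. -/
def ltF (s t : Tm) : Fm := .ex 92 (.eq (plusT s (succT (V 92))) t)

/-- `Var(t)`. -/
def isVarF (t : Tm) : Fm := .ex 90 (.eq t (prT (numeral 1) (V 90)))

def isTmF (t : Tm) : Fm := .eq (tmT t) oneT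

def isFmF (t : Tm) : Fm := .eq (fmT t) oneT

/-- `v` is a variable that is free in the term or formula `t`. -/
def freeF (t v : Tm) : Fm := .eq (fvT t v) oneT

/-- `t` is free for the variable `v` in the formula `x`. -/
def freeForF (x t v : Tm) : Fm := .eq (ffT x t v) oneT

/-- `CT(t)`: `t` is the code of a closed term. -/
def CTF (t : Tm) : Fm := (isTmF t).and (.all 91 (freeF t (V 91)).neg)

/-- `Sent(t)`: `t` is the code of a sentence of the language with the truth predicate. -/
def SentF (t : Tm) : Fm := (isFmF t).and (.all 91 (freeF t (V 91)).neg)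

/-- `v` is the value of the closed term (with code) `t`: some finite list of pairs contains
`⟨t, v⟩`, and every pair in it arises by one of the evaluation clauses from pairs in it. -/
def valF (t v : Tm) : Fm :=
  .ex 80 ((Fm.eq (memT (prT t v) (V 80)) oneT).and
    (.all 81 ((Fm.eq (memT (V 81) (V 80)) oneT).imp
      (disjF (Fn.all.map fun f =>
        Fm.exs ((List.range f.1).map (60 + ·)) (Fm.exs ((List.range f.1).map (70 + ·))
          ((Fm.eq (V 81)
            (prT (nodeT f.2.tag (List.ofFn fun i : Fin f.1 => V (60 + i)))
              (.app f.2 fun i => V (70 + i)))).and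
            (conjF (List.ofFn fun i : Fin f.1 =>
              Fm.eq (memT (prT (V (60 + i)) (V (70 + i))) (V 80)) oneT)))))))))

/-- `s° = t°`. -/
def sameValF (s t : Tm) : Fm := .ex 85 ((valF s (V 85)).and (valF t (V 85)))

/-- `⌜φ⌝`, the numeral of the code of `φ`. -/
def quoteT (φ : Fm) : Tm := numeral φ.code

/-- `⌜φ(ẋ)⌝`, where `φ` has at most the variable `v₀` free and `x` is the value of `s`. -/
def dotT (φ : Fm) (s : Tm) : Tm := subT (quoteT φ) (numT s) (numeral (varCode 0))

/-! ### The theory PAT -/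

/-- The axioms for zero, successor, sum and product. -/
def arithAx : List Fm :=
  [.all 0 (Fm.eq (succT (V 0)) zeroT).neg,
   Fm.alls [0, 1] ((Fm.eq (succT (V 0)) (succT (V 1))).imp (.eq (V 0) (V 1))),
   .all 0 (.eq (plusT (V 0) zeroT) (V 0)),
   Fm.alls [0, 1] (.eq (plusT (V 0) (succT (V 1))) (succT (plusT (V 0) (V 1)))),
   .all 0 (.eq (timesT (V 0) zeroT) zeroT),
   Fm.alls [0, 1] (.eq (timesT (V 0) (succT (V 1))) (plusT (timesT (V 0) (V 1)) (V 0)))]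

/-- The defining axioms of pairing, of the symbols for the syntactic constructors, of numerals, of
list membership and of quantifier prefixes. -/
def basicDefAx : List Fm :=
  [Fm.alls [0, 1] ((ltF (V 0) (V 1)).imp
     (.eq (prT (V 0) (V 1)) (plusT (timesT (V 1) (V 1)) (V 0)))),
   Fm.alls [0, 1] ((ltF (V 0) (V 1)).neg.imp
     (.eq (prT (V 0) (V 1)) (plusT (plusT (timesT (V 0) (V 0)) (V 0)) (V 1)))),
   Fm.alls [0, 1] (.eq (dEqT (V 0) (V 1)) (nodeT 2 [V 0, V 1])),
   .all 0 (.eq (dNegT (V 0)) (nodeT 4 [V 0])),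
   Fm.alls [0, 1] (.eq (dOrT (V 0) (V 1)) (nodeT 5 [V 0, V 1])),
   Fm.alls [0, 1] (.eq (dAndT (V 0) (V 1)) (nodeT 6 [V 0, V 1])),
   Fm.alls [0, 1] (.eq (dAllT (V 0) (V 1)) (nodeT 7 [V 0, V 1])),
   Fm.alls [0, 1] (.eq (dExT (V 0) (V 1)) (nodeT 8 [V 0, V 1])),
   .eq (numT zeroT) (nodeT (Fn.tag .zero) []),
   .all 0 (.eq (numT (succT (V 0))) (nodeT (Fn.tag .succ) [numT (V 0)])),
   .all 0 (.eq (memT (V 0) zeroT) zeroT),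
   Fm.alls [0, 1] (.eq (memT (V 0) (succT (prT (V 0) (V 1)))) oneT),
   Fm.alls [0, 1, 2] ((Fm.eq (V 0) (V 2)).neg.imp
     (.eq (memT (V 0) (succT (prT (V 2) (V 1)))) (memT (V 0) (V 1)))),
   .all 0 (.eq (genT zeroT (V 0)) (V 0)),
   Fm.alls [0, 1, 2] (.eq (genT (succT (prT (V 0) (V 1))) (V 2))
     (dAllT (V 0) (genT (V 1) (V 2))))]

/-- The recursive definition of the codes of terms. -/
def tmAx : List Fm :=
  [.all 0 (.eq (tmT (prT (numeral 1) (V 0))) oneT),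
   .all 9 ((conjF ((isVarF (V 9)).neg :: Fn.all.map fun f =>
       (Fm.exs (List.range f.1)
         (.eq (V 9) (nodeT f.2.tag (List.ofFn fun i : Fin f.1 => V i)))).neg)).imp
     (.eq (tmT (V 9)) zeroT))] ++
  Fn.all.map fun f => Fm.alls (List.range f.1)
    (.eq (tmT (nodeT f.2.tag (List.ofFn fun i : Fin f.1 => V i)))
      (prodT (List.ofFn fun i : Fin f.1 => tmT (V i))))

/-- The recursive definition of the codes of formulas. -/
def fmAx : List Fm :=
  [Fm.alls [0, 1] (.eq (fmT (nodeT 2 [V 0, V 1])) (timesT (tmT (V 0)) (tmT (V 1)))),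
   .all 0 (.eq (fmT (nodeT 3 [V 0])) (tmT (V 0))),
   .all 0 (.eq (fmT (nodeT 4 [V 0])) (fmT (V 0))),
   Fm.alls [0, 1] (.eq (fmT (nodeT 5 [V 0, V 1])) (timesT (fmT (V 0)) (fmT (V 1)))),
   Fm.alls [0, 1] (.eq (fmT (nodeT 6 [V 0, V 1])) (timesT (fmT (V 0)) (fmT (V 1)))),
   Fm.alls [0, 1] ((isVarF (V 0)).imp (.eq (fmT (nodeT 7 [V 0, V 1])) (fmT (V 1)))),
   Fm.alls [0, 1] ((isVarF (V 0)).neg.imp (.eq (fmT (nodeT 7 [V 0, V 1])) zeroT)),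
   Fm.alls [0, 1] ((isVarF (V 0)).imp (.eq (fmT (nodeT 8 [V 0, V 1])) (fmT (V 1)))),
   Fm.alls [0, 1] ((isVarF (V 0)).neg.imp (.eq (fmT (nodeT 8 [V 0, V 1])) zeroT)),
   .all 9 ((conjF [
       (Fm.exs [0, 1] (.eq (V 9) (nodeT 2 [V 0, V 1]))).neg,
       (Fm.exs [0] (.eq (V 9) (nodeT 3 [V 0]))).neg,
       (Fm.exs [0] (.eq (V 9) (nodeT 4 [V 0]))).neg,
       (Fm.exs [0, 1] (.eq (V 9) (nodeT 5 [V 0, V 1]))).neg,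
       (Fm.exs [0, 1] (.eq (V 9) (nodeT 6 [V 0, V 1]))).neg,
       (Fm.exs [0, 1] (.eq (V 9) (nodeT 7 [V 0, V 1]))).neg,
       (Fm.exs [0, 1] (.eq (V 9) (nodeT 8 [V 0, V 1]))).neg]).imp
     (.eq (fmT (V 9)) zeroT))]

/-- Tags and arities of the symbols that bind no variable: function symbols, equality, the truth
predicate and the connectives. -/
def plainTags : List (ℕ × ℕ) :=
  (Fn.all.map fun f => (f.2.tag, f.1)) ++ [(2, 2), (3, 1), (4, 1), (5, 2), (6, 2)]

/-- `t` is the code of a term or of a formula. -/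
def isExprF (t : Tm) : Fm := (isTmF t).or (isFmF t)

/-- The list `v₀, …, v_{k-1}` of variables. -/
def varsT (k : ℕ) : List Tm := (List.range k).map V

/-- The recursive definition of free variables. -/
def fvAx : List Fm :=
  [Fm.alls [0, 1] ((Fm.eq (fvT (V 0) (V 1)) zeroT).or (.eq (fvT (V 0) (V 1)) oneT)),
   Fm.alls [0, 1] ((freeF (V 0) (V 1)).imp ((isExprF (V 0)).and (isVarF (V 1)))),
   Fm.alls [0, 1] ((freeF (prT (numeral 1) (V 0)) (V 1)).iff
     (.eq (V 1) (prT (numeral 1) (V 0))))] ++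
  (plainTags.map fun p => Fm.alls (9 :: List.range p.2)
    ((isExprF (nodeT p.1 (varsT p.2))).imp
      ((freeF (nodeT p.1 (varsT p.2)) (V 9)).iff
        (disjF ((varsT p.2).map fun x => freeF x (V 9)))))) ++
  ([7, 8].map fun q => Fm.alls [0, 1, 9]
    ((isFmF (nodeT q [V 0, V 1])).imp
      ((freeF (nodeT q [V 0, V 1]) (V 9)).iff
        ((Fm.eq (V 0) (V 9)).neg.and (freeF (V 1) (V 9))))))

/-- The recursive definition of substitution. -/
def subAx : List Fm :=
  [Fm.alls [0, 8, 9] (((isExprF (V 0)).and ((isTmF (V 8)).and (isVarF (V 9)))).neg.imp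
     (.eq (subT (V 0) (V 8) (V 9)) zeroT)),
   Fm.alls [8, 9] (((isTmF (V 8)).and (isVarF (V 9))).imp
     (.eq (subT (V 9) (V 8) (V 9)) (V 8))),
   Fm.alls [0, 8, 9] (((isVarF (V 0)).and ((Fm.eq (V 0) (V 9)).neg.and
       ((isTmF (V 8)).and (isVarF (V 9))))).imp
     (.eq (subT (V 0) (V 8) (V 9)) (V 0)))] ++
  (plainTags.map fun p => Fm.alls (8 :: 9 :: List.range p.2)
    (((isExprF (nodeT p.1 (varsT p.2))).and ((isTmF (V 8)).and (isVarF (V 9)))).imp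
      (.eq (subT (nodeT p.1 (varsT p.2)) (V 8) (V 9))
        (nodeT p.1 ((varsT p.2).map fun x => subT x (V 8) (V 9)))))) ++
  ([7, 8].map fun q => Fm.alls [0, 1, 8, 9]
    (((isFmF (nodeT q [V 0, V 1])).and ((isTmF (V 8)).and (isVarF (V 9)))).imp
      (((Fm.eq (V 0) (V 9)).imp
        (.eq (subT (nodeT q [V 0, V 1]) (V 8) (V 9)) (nodeT q [V 0, V 1]))).and
      ((Fm.eq (V 0) (V 9)).neg.imp
        (.eq (subT (nodeT q [V 0, V 1]) (V 8) (V 9))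
          (nodeT q [V 0, subT (V 1) (V 8) (V 9)]))))))

/-- The recursive definition of "`t` is free for `v` in `x`". -/
def ffAx : List Fm :=
  [Fm.alls [0, 8, 9] ((Fm.eq (ffT (V 0) (V 8) (V 9)) zeroT).or
     (.eq (ffT (V 0) (V 8) (V 9)) oneT)),
   Fm.alls [0, 8, 9] ((freeForF (V 0) (V 8) (V 9)).imp
     ((isFmF (V 0)).and ((isTmF (V 8)).and (isVarF (V 9))))),
   Fm.alls [0, 1, 8, 9] (((isFmF (nodeT 2 [V 0, V 1])).and ((isTmF (V 8)).and (isVarF (V 9)))).imp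
     (freeForF (nodeT 2 [V 0, V 1]) (V 8) (V 9))),
   Fm.alls [0, 8, 9] (((isFmF (nodeT 3 [V 0])).and ((isTmF (V 8)).and (isVarF (V 9)))).imp
     (freeForF (nodeT 3 [V 0]) (V 8) (V 9))),
   Fm.alls [0, 8, 9] ((freeForF (nodeT 4 [V 0]) (V 8) (V 9)).iff (freeForF (V 0) (V 8) (V 9))),
   Fm.alls [0, 1, 8, 9] ((freeForF (nodeT 5 [V 0, V 1]) (V 8) (V 9)).iff
     ((freeForF (V 0) (V 8) (V 9)).and (freeForF (V 1) (V 8) (V 9)))),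
   Fm.alls [0, 1, 8, 9] ((freeForF (nodeT 6 [V 0, V 1]) (V 8) (V 9)).iff
     ((freeForF (V 0) (V 8) (V 9)).and (freeForF (V 1) (V 8) (V 9))))] ++
  ([7, 8].map fun q => Fm.alls [0, 1, 8, 9]
    (((isFmF (nodeT q [V 0, V 1])).and ((isTmF (V 8)).and (isVarF (V 9)))).imp
      ((freeForF (nodeT q [V 0, V 1]) (V 8) (V 9)).iff
        ((freeF (nodeT q [V 0, V 1]) (V 9)).neg.or
          ((freeF (V 8) (V 0)).neg.and (freeForF (V 1) (V 8) (V 9)))))))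

/-- The finitely many axioms of PAT other than induction. -/
def finAx : List Fm := arithAx ++ basicDefAx ++ tmAx ++ fmAx ++ fvAx ++ subAx ++ ffAx

/-- The induction formula for `φ` and the variable `vₙ`. -/
def indF (n : ℕ) (φ : Fm) : Fm :=
  ((φ.subst n zeroT).and (.all n (φ.imp (φ.subst n (succT (V n)))))).imp (.all n φ)

/-- PAT: Peano arithmetic, with the defining axioms of the additional function symbols and with
(universal closures of) induction for all formulas of the language with the truth predicate. -/
def PAT : Set Fm :=
  {φ | φ ∈ finAx ∨ (φ.IsSentence ∧ ∃ vs n ψ, φ = Fm.alls vs (indF n ψ))}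

/-! ### The formula `Ax_PAT` -/

/-- `t` is the code of an instance of one of the schemes `LogAx`. -/
def logAxF (t : Tm) : Fm :=
  disjF [
    Fm.exs [30, 31] ((conjF [isFmF (V 30), isFmF (V 31)]).and
      (.eq t (dImpT (V 30) (dImpT (V 31) (V 30))))),
    Fm.exs [30, 31, 32] ((conjF [isFmF (V 30), isFmF (V 31), isFmF (V 32)]).and
      (.eq t (dImpT (dImpT (V 30) (dImpT (V 31) (V 32)))
        (dImpT (dImpT (V 30) (V 31)) (dImpT (V 30) (V 32)))))),
    Fm.exs [30, 31] ((conjF [isFmF (V 30), isFmF (V 31)]).and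
      (.eq t (dImpT (dImpT (dNegT (V 30)) (dNegT (V 31))) (dImpT (V 31) (V 30))))),
    Fm.exs [30, 31] ((conjF [isFmF (V 30), isFmF (V 31)]).and
      (.eq t (dImpT (V 30) (dOrT (V 30) (V 31))))),
    Fm.exs [30, 31] ((conjF [isFmF (V 30), isFmF (V 31)]).and
      (.eq t (dImpT (V 31) (dOrT (V 30) (V 31))))),
    Fm.exs [30, 31, 32] ((conjF [isFmF (V 30), isFmF (V 31), isFmF (V 32)]).and
      (.eq t (dImpT (dImpT (V 30) (V 32)) (dImpT (dImpT (V 31) (V 32))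
        (dImpT (dOrT (V 30) (V 31)) (V 32)))))),
    Fm.exs [30, 31] ((conjF [isFmF (V 30), isFmF (V 31)]).and
      (.eq t (dImpT (dAndT (V 30) (V 31)) (V 30)))),
    Fm.exs [30, 31] ((conjF [isFmF (V 30), isFmF (V 31)]).and
      (.eq t (dImpT (dAndT (V 30) (V 31)) (V 31)))),
    Fm.exs [30, 31] ((conjF [isFmF (V 30), isFmF (V 31)]).and
      (.eq t (dImpT (V 30) (dImpT (V 31) (dAndT (V 30) (V 31)))))),
    Fm.exs [30, 31, 40] ((conjF [isFmF (V 30), isFmF (V 31), isVarF (V 40)]).and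
      (.eq t (dImpT (dAllT (V 40) (dImpT (V 30) (V 31)))
        (dImpT (dAllT (V 40) (V 30)) (dAllT (V 40) (V 31)))))),
    Fm.exs [30, 40] ((conjF [isFmF (V 30), isVarF (V 40), (freeF (V 30) (V 40)).neg]).and
      (.eq t (dImpT (V 30) (dAllT (V 40) (V 30))))),
    Fm.exs [30, 40, 50] ((freeForF (V 30) (V 50) (V 40)).and
      (.eq t (dImpT (dAllT (V 40) (V 30)) (subT (V 30) (V 50) (V 40))))),
    Fm.exs [30, 40, 50] ((freeForF (V 30) (V 50) (V 40)).and
      (.eq t (dImpT (subT (V 30) (V 50) (V 40)) (dExT (V 40) (V 30))))),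
    Fm.exs [30, 31, 40] ((conjF [isFmF (V 30), isFmF (V 31), isVarF (V 40),
        (freeF (V 31) (V 40)).neg]).and
      (.eq t (dImpT (dAllT (V 40) (dImpT (V 30) (V 31))) (dImpT (dExT (V 40) (V 30)) (V 31))))),
    Fm.exs [50] ((isTmF (V 50)).and (.eq t (dEqT (V 50) (V 50)))),
    Fm.exs [30, 40, 50, 51] ((conjF [freeForF (V 30) (V 50) (V 40),
        freeForF (V 30) (V 51) (V 40)]).and
      (.eq t (dImpT (dEqT (V 50) (V 51))
        (dImpT (subT (V 30) (V 50) (V 40)) (subT (V 30) (V 51) (V 40))))))]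

/-- `t` is the code of an induction formula. -/
def indAxF (t : Tm) : Fm :=
  Fm.exs [30, 40] ((conjF [isFmF (V 30), isVarF (V 40)]).and
    (.eq t (dImpT
      (dAndT (subT (V 30) (numeral zeroT.code) (V 40))
        (dAllT (V 40) (dImpT (V 30) (subT (V 30) (nodeT (Fn.tag .succ) [V 40]) (V 40)))))
      (dAllT (V 40) (V 30)))))

/-- `Ax_PAT(t)`: `t` is the code of an axiom of PAT or of a logical axiom that is a sentence. -/
def AxPATF (t : Tm) : Fm :=
  (disjF (finAx.map fun φ => .eq t (quoteT φ))).or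
    ((SentF t).and (Fm.exs [20, 21]
      ((Fm.eq t (genT (V 20) (V 21))).and ((logAxF (V 21)).or (indAxF (V 21))))))

/-! ### The theories VFM and VFM⁻ -/

def VF1 : Fm :=
  Fm.alls [0, 1] (((CTF (V 0)).and (CTF (V 1))).imp
    (((Fm.tr (dEqT (V 0) (V 1))).iff (sameValF (V 0) (V 1))).and
      ((Fm.tr (dNegT (dEqT (V 0) (V 1)))).iff (sameValF (V 0) (V 1)).neg)))

def VF2 : Fm := .all 0 ((AxPATF (V 0)).imp (.tr (V 0)))

/-- `∀x ∀v (∀z Tr(x(ż/v)) → Tr(∀̣v x))`, where `ż` is the numeral of `z`. -/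
def VF3 : Fm :=
  Fm.alls [0, 1] ((Fm.all 2 (.tr (subT (V 0) (numT (V 2)) (V 1)))).imp
    (.tr (dAllT (V 1) (V 0))))

def VF4 : Fm := .all 0 ((Fm.tr (V 0)).iff (.tr (dotT (.tr (V 0)) (V 0))))

/-- The left-to-right half of `VF4`. -/
def VF4star : Fm := .all 0 ((Fm.tr (V 0)).imp (.tr (dotT (.tr (V 0)) (V 0))))

def VF5 : Fm :=
  .all 0 ((SentF (V 0)).imp
    ((Fm.tr (dNegT (dotT (.tr (V 0)) (V 0)))).iff (.tr (dNegT (V 0)))))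

def VF6 : Fm :=
  Fm.alls [0, 1] ((Fm.tr (dImpT (V 0) (V 1))).imp ((Fm.tr (V 0)).imp (.tr (V 1))))

def VF7 : Fm :=
  .all 0 (.tr (dotT ((SentF (V 0)).imp ((Fm.tr (V 0)).neg.iff (.tr (dNegT (V 0))))) (V 0)))

def VF8 : Fm := .all 0 (.tr (dotT ((Fm.tr (V 0)).imp (SentF (V 0))) (V 0)))

def VFM : Set Fm := PAT ∪ {VF1, VF2, VF3, VF4, VF5, VF6, VF7, VF8}

def VFMminus : Set Fm := PAT ∪ {VF1, VF2, VF3, VF4star, VF5, VF6, VF7, VF8}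

end SupervalTruth

/-!
The supervaluational fixed points are models of VFM because of two facts. Let `X` be a fixed point
of the jump, so that `X` consists of the sentences that hold in `(ℕ, X')` for all maximally
consistent `X' ⊇ X`.

* By soundness `X` is closed under derivability (`code_mem_of_proves`). With Lindenbaum's lemma
  (`exists_MCX_superset`) it follows that `X` is the intersection of its maximally consistent
  extensions (`code_mem_iff_forall_mem`). The sentence `Tr(n̄)` belongs to `X` if and only if `n`
  belongs to all these extensions, hence if and only if `n ∈ X`. This is VF4, and VF5 is the same
  argument for a negation, since a maximally consistent set contains exactly one of `φ` and `¬φ`.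
  VF6 is closure under modus ponens; VF7 and VF8 say that every `X'` is a complete and consistent
  set of sentences.
* The arithmetical part of the language has its intended interpretation in every `(ℕ, X')`, so the
  axioms of PAT, the logical axioms and the ω-rule are sound for membership in `X`, which gives VF2
  and VF3; VF1 says that arithmetical atoms are decided correctly. What has to be verified is that
  the arithmetized syntax denotes what it should: that the recursion equations of PAT hold for the
  syntactic functions (`models_finAx`), that `valF` defines the value of closed terms (`sat_valF`,
  `IsEvalList.val_eq`, `exists_isEvalList`), and that only codes of axioms satisfy `Ax_PAT`
  (`exists_of_sat_AxPATF`).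

The right-to-left half of VF4 and the left-to-right halves of VF1 need some maximally consistent
`X' ⊇ X`. If there were none, every sentence would belong to `X = jumpMC X`, and `X` would contain
a sentence together with its negation (`exists_MCX_of_inter_antiext`).

The consistency of VFM and VFM⁻ follows by soundness once there is a consistent fixed point. The
jump of a consistent `S` is consistent, as it holds in `(ℕ, S')` for a maximally consistent
`S' ⊇ S`, and consistency is preserved by unions of chains. By Zorn's lemma there is a maximal
consistent `S` with `S ⊆ jumpMC S`, and it is a fixed point (`exists_consistent_fixedPoint`).
-/

namespace SupervalTruth

/-! ### Syntax: free variables and substitution -/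

theorem Tm.subst_of_not_occ {n : ℕ} {u : Tm} (t : Tm) (h : ¬ u.Occ n) : u.subst n t = u := by
  induction u with
  | var m => exact if_neg h
  | app f ts ih =>
    simp only [Tm.Occ, not_exists] at h
    simp only [Tm.subst]
    congr 1
    exact funext fun i => ih i (h i)

theorem Fm.subst_of_not_free {n : ℕ} {φ : Fm} (t : Tm) (h : ¬ φ.Free n) : φ.subst n t = φ := by
  induction φ with
  | eq r s =>
    simp only [Fm.Free, not_or] at h
    simp [Fm.subst, Tm.subst_of_not_occ t h.1, Tm.subst_of_not_occ t h.2]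
  | tr s => simp [Fm.subst, Tm.subst_of_not_occ t h]
  | neg φ ih => simp [Fm.subst, ih h]
  | or φ ψ ih₁ ih₂ =>
    simp only [Fm.Free, not_or] at h
    simp [Fm.subst, ih₁ h.1, ih₂ h.2]
  | and φ ψ ih₁ ih₂ =>
    simp only [Fm.Free, not_or] at h
    simp [Fm.subst, ih₁ h.1, ih₂ h.2]
  | all m φ ih =>
    by_cases hm : m = n
    · simp [Fm.subst, hm]
    · simp only [Fm.Free, not_and] at h
      simp [Fm.subst, hm, ih (h hm)]
  | ex m φ ih =>
    by_cases hm : m = n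
    · simp [Fm.subst, hm]
    · simp only [Fm.Free, not_and] at h
      simp [Fm.subst, hm, ih (h hm)]

/-- `t` is a closed term. -/
def Tm.Closed (t : Tm) : Prop := ∀ n, ¬ t.Occ n

theorem closed_numeral (k : ℕ) : (numeral k).Closed := by
  induction k with
  | zero => rintro n ⟨i, -⟩; exact i.elim0
  | succ k ih =>
    rintro n ⟨i, hi⟩
    rw [Subsingleton.elim i 0] at hi
    exact ih n hi

theorem Tm.occ_subst_of_closed {t : Tm} (ht : t.Closed) (n k : ℕ) (u : Tm) :
    (u.subst n t).Occ k ↔ u.Occ k ∧ k ≠ n := by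
  induction u with
  | var m =>
    by_cases hm : m = n
    · subst hm
      simp only [Tm.subst, if_true, ht k, Tm.Occ, false_iff, not_and, not_not]
      exact fun h => h.symm
    · simp only [Tm.subst, hm, if_false, Tm.Occ]
      exact ⟨fun h => ⟨h, h ▸ hm⟩, fun h => h.1⟩
  | app f ts ih => simp [Tm.subst, Tm.Occ, ih]

theorem Fm.free_subst_of_closed {t : Tm} (ht : t.Closed) (n k : ℕ) (φ : Fm) :
    (φ.subst n t).Free k ↔ φ.Free k ∧ k ≠ n := by
  induction φ with
  | eq r s => simp [Fm.subst, Fm.Free, Tm.occ_subst_of_closed ht, or_and_right]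
  | tr s => simp [Fm.subst, Fm.Free, Tm.occ_subst_of_closed ht]
  | neg φ ih => simp [Fm.subst, Fm.Free, ih]
  | or φ ψ ih₁ ih₂ => simp [Fm.subst, Fm.Free, ih₁, ih₂, or_and_right]
  | and φ ψ ih₁ ih₂ => simp [Fm.subst, Fm.Free, ih₁, ih₂, or_and_right]
  | all m φ ih =>
    by_cases hm : m = n
    · subst hm
      simp only [Fm.subst, if_true, Fm.Free]
      tauto
    · simp [Fm.subst, hm, Fm.Free, ih, and_assoc]
  | ex m φ ih =>
    by_cases hm : m = n
    · subst hm
      simp only [Fm.subst, if_true, Fm.Free]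
      tauto
    · simp [Fm.subst, hm, Fm.Free, ih, and_assoc]

theorem Fm.freeFor_of_closed {t : Tm} (ht : t.Closed) (n : ℕ) (φ : Fm) : φ.FreeFor n t := by
  induction φ with
  | eq | tr => trivial
  | neg φ ih => exact ih
  | or φ ψ ih₁ ih₂ => exact ⟨ih₁, ih₂⟩
  | and φ ψ ih₁ ih₂ => exact ⟨ih₁, ih₂⟩
  | all m φ ih => exact .inr ⟨ht m, ih⟩
  | ex m φ ih => exact .inr ⟨ht m, ih⟩

/-- In `φ(S(vₙ)/vₙ)` no variable is captured, since a quantifier `∀vₙ` or `∃vₙ` already blocks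
the substitution. -/
theorem Fm.freeFor_of_occ_only {t : Tm} {n : ℕ} (ht : ∀ m, t.Occ m → m = n) (φ : Fm) :
    φ.FreeFor n t := by
  induction φ with
  | eq | tr => trivial
  | neg φ ih => exact ih
  | or φ ψ ih₁ ih₂ => exact ⟨ih₁, ih₂⟩
  | and φ ψ ih₁ ih₂ => exact ⟨ih₁, ih₂⟩
  | all m φ ih =>
    by_cases hm : m = n
    · exact .inl fun h => h.1 hm
    · exact .inr ⟨fun h => hm (ht m h), ih⟩
  | ex m φ ih =>
    by_cases hm : m = n
    · exact .inl fun h => h.1 hm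
    · exact .inr ⟨fun h => hm (ht m h), ih⟩

/-- A computable list of the variables of a term. -/
def Tm.fvs : Tm → List ℕ
  | .var n => [n]
  | .app _ ts => (List.ofFn fun i => (ts i).fvs).flatten

/-- A computable list of the free variables of a formula. -/
def Fm.fvs : Fm → List ℕ
  | .eq s t => s.fvs ++ t.fvs
  | .tr t => t.fvs
  | .neg φ => φ.fvs
  | .or φ ψ => φ.fvs ++ ψ.fvs
  | .and φ ψ => φ.fvs ++ ψ.fvs
  | .all m φ => φ.fvs.filter (m ≠ ·)
  | .ex m φ => φ.fvs.filter (m ≠ ·)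

theorem Tm.mem_fvs {n : ℕ} (t : Tm) : n ∈ t.fvs ↔ t.Occ n := by
  induction t with
  | var m => simp [Tm.fvs, Tm.Occ, eq_comm]
  | app f ts ih => simp [Tm.fvs, Tm.Occ, List.mem_ofFn, ih]

theorem Fm.mem_fvs {n : ℕ} (φ : Fm) : n ∈ φ.fvs ↔ φ.Free n := by
  induction φ with
  | eq s t => simp [Fm.fvs, Fm.Free, Tm.mem_fvs]
  | tr t => simp [Fm.fvs, Fm.Free, Tm.mem_fvs]
  | neg φ ih => simp [Fm.fvs, Fm.Free, ih]
  | or φ ψ ih₁ ih₂ => simp [Fm.fvs, Fm.Free, ih₁, ih₂]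
  | and φ ψ ih₁ ih₂ => simp [Fm.fvs, Fm.Free, ih₁, ih₂]
  | all m φ ih => simp [Fm.fvs, Fm.Free, ih, and_comm]
  | ex m φ ih => simp [Fm.fvs, Fm.Free, ih, and_comm]

theorem isSentence_of_mem_finAx {φ : Fm} (h : φ ∈ finAx) : φ.IsSentence := by
  -- There are finitely many axioms, so their closedness is a computation.
  have key : ∀ φ ∈ finAx, φ.fvs = [] := by decide +kernel
  intro n hn
  simpa [key φ h] using (Fm.mem_fvs φ).2 hn

/-! ### Gödel codes -/

theorem Fn.all_getElem_tag {k : ℕ} (f : Fn k) : Fn.all[f.tag - 10]? = some ⟨k, f⟩ := by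
  cases f <;> rfl

theorem Fn.mem_all {k : ℕ} (f : Fn k) : (⟨k, f⟩ : Σ k, Fn k) ∈ Fn.all :=
  List.mem_of_getElem? f.all_getElem_tag

theorem Fn.tag_inj {k l : ℕ} {f : Fn k} {g : Fn l} (h : f.tag = g.tag) :
    (⟨k, f⟩ : Σ k, Fn k) = ⟨l, g⟩ := by
  have := f.all_getElem_tag
  rw [h, g.all_getElem_tag] at this
  exact (Option.some.inj this).symm

theorem Fn.ten_le_tag {k : ℕ} (f : Fn k) : 10 ≤ f.tag := by
  cases f <;> decide

theorem Fn.arity_le {k : ℕ} (f : Fn k) : k ≤ 3 := by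
  cases f <;> decide

/-- The list of codes of the parts is padded by a final `0`, so that its length is not determined
by the code; it is determined by the tag of the main symbol. -/
theorem node_inj {p q : ℕ} {xs ys : List ℕ} (hl : xs.length = ys.length)
    (h : node p xs = node q ys) : p = q ∧ xs = ys := by
  rw [node, node, Nat.pair_eq_pair] at h
  refine ⟨h.1, ?_⟩
  obtain ⟨-, h⟩ := h
  induction xs generalizing ys with
  | nil => exact (List.length_eq_zero_iff.1 hl.symm).symm
  | cons x xs ih =>
    cases ys with
    | nil => simp at hl
    | cons y ys =>
      simp only [List.foldr_cons, Nat.pair_eq_pair] at h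
      rw [h.1, ih (by simpa using hl) h.2]

theorem tag_eq_of_node_eq {p q : ℕ} {xs ys : List ℕ} (h : node p xs = node q ys) : p = q :=
  (Nat.pair_eq_pair.1 h).1

theorem varCode_inj {m n : ℕ} : varCode m = varCode n ↔ m = n := by
  simp [varCode, Nat.pair_eq_pair]

theorem varCode_ne_node_tag {k : ℕ} (f : Fn k) (n : ℕ) (xs : List ℕ) :
    varCode n ≠ node f.tag xs := fun h => by
  have := (Nat.pair_eq_pair.1 h).1
  have := f.ten_le_tag
  omega

theorem Tm.code_injective : Function.Injective Tm.code := by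
  intro t
  induction t with
  | var n =>
    intro u h
    cases u with
    | var m => rw [varCode_inj.1 h]
    | app g us => exact (varCode_ne_node_tag g n _ h).elim
  | app f ts ih =>
    intro u h
    cases u with
    | var m => exact (varCode_ne_node_tag f m _ h.symm).elim
    | app g us =>
      cases Fn.tag_inj (tag_eq_of_node_eq h)
      have := List.ofFn_injective (node_inj (by simp) h).2
      congr 1
      exact funext fun i => ih i (congrFun this i)

theorem Tm.code_inj {s t : Tm} : s.code = t.code ↔ s = t := Tm.code_injective.eq_iff

theorem Fm.code_injective : Function.Injective Fm.code := by
  intro φ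
  induction φ with
  | eq s t =>
    intro ψ h
    cases ψ <;> simp_all [Fm.code, node, Nat.pair_eq_pair, Tm.code_inj]
  | tr t =>
    intro ψ h
    cases ψ <;> simp_all [Fm.code, node, Nat.pair_eq_pair, Tm.code_inj]
  | neg φ ih =>
    intro ψ h
    cases ψ <;> simp [Fm.code, node, Nat.pair_eq_pair] at h ⊢
    exact ih h
  | or φ ψ ih₁ ih₂ =>
    intro χ h
    cases χ <;> simp [Fm.code, node, Nat.pair_eq_pair] at h ⊢
    exact ⟨ih₁ h.1, ih₂ h.2⟩
  | and φ ψ ih₁ ih₂ =>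
    intro χ h
    cases χ <;> simp [Fm.code, node, Nat.pair_eq_pair] at h ⊢
    exact ⟨ih₁ h.1, ih₂ h.2⟩
  | all m φ ih =>
    intro χ h
    cases χ <;> simp [Fm.code, node, Nat.pair_eq_pair, varCode_inj] at h ⊢
    exact ⟨h.1, ih h.2⟩
  | ex m φ ih =>
    intro χ h
    cases χ <;> simp [Fm.code, node, Nat.pair_eq_pair, varCode_inj] at h ⊢
    exact ⟨h.1, ih h.2⟩

theorem Fm.code_inj {φ ψ : Fm} : φ.code = ψ.code ↔ φ = ψ := Fm.code_injective.eq_iff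

theorem Fm.code_tag (φ : Fm) : 2 ≤ φ.code.unpair.1 ∧ φ.code.unpair.1 ≤ 8 := by
  cases φ <;> simp [Fm.code, node]

theorem Tm.code_tag (t : Tm) : t.code.unpair.1 = 1 ∨ 10 ≤ t.code.unpair.1 := by
  cases t with
  | var n => simp [Tm.code, varCode]
  | app f ts => simp [Tm.code, node, f.ten_le_tag]

theorem Tm.code_ne_code (t : Tm) (φ : Fm) : t.code ≠ φ.code := fun h => by
  have := t.code_tag
  have := φ.code_tag
  rw [← h] at this
  omega

theorem Fm.code_ne_zero (φ : Fm) : φ.code ≠ 0 := fun h => by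
  have := φ.code_tag
  simp [h] at this

/-- The code of a term. -/
def IsTmCode (x : ℕ) : Prop := ∃ t : Tm, t.code = x

/-- The code of a formula. -/
def IsFmCode (x : ℕ) : Prop := ∃ φ : Fm, φ.code = x

theorem isTmCode_varCode (n : ℕ) : IsTmCode (varCode n) := ⟨.var n, rfl⟩

theorem Tm.eq_app_of_code {t : Tm} {k : ℕ} {f : Fn k} {a : Fin k → ℕ}
    (h : t.code = node f.tag (List.ofFn a)) :
    ∃ ts : Fin k → Tm, t = .app f ts ∧ ∀ i, (ts i).code = a i := by
  cases t with
  | var m => exact (varCode_ne_node_tag f m _ h).elim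
  | app g us =>
    cases Fn.tag_inj (tag_eq_of_node_eq h)
    exact ⟨us, rfl, congrFun (List.ofFn_injective (node_inj (by simp) h).2)⟩

theorem isTmCode_node {k : ℕ} (f : Fn k) (a : Fin k → ℕ) :
    IsTmCode (node f.tag (List.ofFn a)) ↔ ∀ i, IsTmCode (a i) := by
  constructor
  · rintro ⟨t, ht⟩ i
    obtain ⟨ts, -, h⟩ := Tm.eq_app_of_code ht
    exact ⟨ts i, h i⟩
  · intro h
    choose ts hts using h
    exact ⟨.app f ts, by simp [Tm.code, hts]⟩

theorem Fm.code_ne_node_tag {k : ℕ} (f : Fn k) (φ : Fm) (xs : List ℕ) :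
    φ.code ≠ node f.tag xs := fun h => by
  have := φ.code_tag
  rw [h] at this
  have := f.ten_le_tag
  simp [node] at *
  omega

theorem Fm.eq_of_code_eq {φ : Fm} {x y : ℕ} (h : φ.code = node 2 [x, y]) :
    ∃ s t : Tm, φ = .eq s t ∧ s.code = x ∧ t.code = y := by
  cases φ <;> simp_all [Fm.code, node, Nat.pair_eq_pair]

theorem Fm.eq_of_code_tr {φ : Fm} {x : ℕ} (h : φ.code = node 3 [x]) :
    ∃ t : Tm, φ = .tr t ∧ t.code = x := by
  cases φ <;> simp_all [Fm.code, node, Nat.pair_eq_pair]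

theorem Fm.eq_of_code_neg {φ : Fm} {x : ℕ} (h : φ.code = node 4 [x]) :
    ∃ ψ : Fm, φ = .neg ψ ∧ ψ.code = x := by
  cases φ <;> simp_all [Fm.code, node, Nat.pair_eq_pair]

theorem Fm.eq_of_code_or {φ : Fm} {x y : ℕ} (h : φ.code = node 5 [x, y]) :
    ∃ ψ χ : Fm, φ = .or ψ χ ∧ ψ.code = x ∧ χ.code = y := by
  cases φ <;> simp_all [Fm.code, node, Nat.pair_eq_pair]

theorem Fm.eq_of_code_and {φ : Fm} {x y : ℕ} (h : φ.code = node 6 [x, y]) :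
    ∃ ψ χ : Fm, φ = .and ψ χ ∧ ψ.code = x ∧ χ.code = y := by
  cases φ <;> simp_all [Fm.code, node, Nat.pair_eq_pair]

theorem Fm.eq_of_code_all {φ : Fm} {x y : ℕ} (h : φ.code = node 7 [x, y]) :
    ∃ (n : ℕ) (ψ : Fm), φ = .all n ψ ∧ varCode n = x ∧ ψ.code = y := by
  cases φ <;> simp_all [Fm.code, node, Nat.pair_eq_pair]

theorem Fm.eq_of_code_ex {φ : Fm} {x y : ℕ} (h : φ.code = node 8 [x, y]) :
    ∃ (n : ℕ) (ψ : Fm), φ = .ex n ψ ∧ varCode n = x ∧ ψ.code = y := by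
  cases φ <;> simp_all [Fm.code, node, Nat.pair_eq_pair]

theorem partialInv_tm_code (t : Tm) : Function.partialInv Tm.code t.code = some t :=
  Function.partialInv_left Tm.code_injective t

theorem subCode_tm (u t : Tm) (n : ℕ) :
    subCode u.code t.code (varCode n) = (u.subst n t).code := by
  have h : Function.partialInv Tm.code (varCode n) = some (.var n) := partialInv_tm_code (.var n)
  simp [subCode, partialInv_tm_code, h]

theorem subCode_fm (φ : Fm) (t : Tm) (n : ℕ) :
    subCode φ.code t.code (varCode n) = (φ.subst n t).code := by
  have h : Function.partialInv Tm.code (varCode n) = some (.var n) := partialInv_tm_code (.var n)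
  have h' : Function.partialInv Tm.code φ.code = none :=
    dif_neg (by rintro ⟨t, ht⟩; exact Tm.code_ne_code t φ ht)
  simp [subCode, partialInv_tm_code, h, h', Function.partialInv_left Fm.code_injective]

/-- Since `0` is not a code, a nonzero value shows that the substitution was meaningful. -/
theorem of_subCode_ne_zero {x t v : ℕ} (h : subCode x t v ≠ 0) :
    (IsTmCode x ∨ IsFmCode x) ∧ IsTmCode t ∧ ∃ n, v = varCode n := by
  have inv {α : Type} {f : α → ℕ} {y : ℕ} {a : α} (h : Function.partialInv f y = some a) :
      f a = y := by
    unfold Function.partialInv at h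
    split at h
    · next hy => cases h; exact hy.choose_spec
    · cases h
  unfold subCode at h
  split at h
  · next s n hs hn =>
    refine ⟨?_, ⟨s, inv hs⟩, n, (inv hn).symm⟩
    split at h
    · next u _ hu => exact .inl ⟨_, inv hu⟩
    · next φ _ hφ => exact .inr ⟨_, inv hφ⟩
    · exact (h rfl).elim
  · exact (h rfl).elim

/-! ### Satisfaction and soundness -/

theorem Fm.sat_imp {X : Set ℕ} {e : ℕ → ℕ} {φ ψ : Fm} :
    (φ.imp ψ).Sat X e ↔ (φ.Sat X e → ψ.Sat X e) := imp_iff_not_or.symm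

theorem Fm.sat_iff {X : Set ℕ} {e : ℕ → ℕ} {φ ψ : Fm} :
    (φ.iff ψ).Sat X e ↔ (φ.Sat X e ↔ ψ.Sat X e) :=
  (and_congr Fm.sat_imp Fm.sat_imp).trans iff_def.symm

theorem Tm.val_congr {e e' : ℕ → ℕ} {t : Tm} (h : ∀ n, t.Occ n → e n = e' n) :
    t.val e = t.val e' := by
  induction t with
  | var n => exact h n rfl
  | app f ts ih =>
    simp only [Tm.val]
    exact congrArg _ (funext fun i => ih i fun n hn => h n ⟨i, hn⟩)

theorem Fm.sat_congr {X : Set ℕ} {φ : Fm} {e e' : ℕ → ℕ} (h : ∀ n, φ.Free n → e n = e' n) :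
    φ.Sat X e ↔ φ.Sat X e' := by
  induction φ generalizing e e' with
  | eq s t =>
    simp only [Fm.Sat]
    rw [Tm.val_congr fun n hn => h n (.inl hn), Tm.val_congr fun n hn => h n (.inr hn)]
  | tr t =>
    simp only [Fm.Sat]
    rw [Tm.val_congr h]
  | neg φ ih => exact not_congr (ih h)
  | or φ ψ ih₁ ih₂ =>
    exact or_congr (ih₁ fun n hn => h n (.inl hn)) (ih₂ fun n hn => h n (.inr hn))
  | and φ ψ ih₁ ih₂ =>
    exact and_congr (ih₁ fun n hn => h n (.inl hn)) (ih₂ fun n hn => h n (.inr hn))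
  | all m φ ih =>
    refine forall_congr' fun k => ih fun n hn => ?_
    by_cases hm : n = m
    · simp [hm]
    · simp [hm, h n ⟨Ne.symm hm, hn⟩]
  | ex m φ ih =>
    refine exists_congr fun k => ih fun n hn => ?_
    by_cases hm : n = m
    · simp [hm]
    · simp [hm, h n ⟨Ne.symm hm, hn⟩]

theorem Fm.IsSentence.models_iff {X : Set ℕ} {φ : Fm} (h : φ.IsSentence) (e : ℕ → ℕ) :
    Models X φ ↔ φ.Sat X e :=
  ⟨fun H => H e, fun H _ => (Fm.sat_congr fun n hn => (h n hn).elim).1 H⟩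

theorem Tm.val_subst (n : ℕ) (t u : Tm) (e : ℕ → ℕ) :
    (u.subst n t).val e = u.val (Function.update e n (t.val e)) := by
  induction u with
  | var m =>
    by_cases hm : m = n
    · simp [Tm.subst, Tm.val, hm]
    · simp [Tm.subst, Tm.val, hm]
  | app f ts ih => simp [Tm.subst, Tm.val, ih]

theorem Fm.sat_subst {X : Set ℕ} {n : ℕ} {t : Tm} {φ : Fm} (h : φ.FreeFor n t) (e : ℕ → ℕ) :
    (φ.subst n t).Sat X e ↔ φ.Sat X (Function.update e n (t.val e)) := by
  -- A quantified formula in which `vₙ` is not free is left unchanged.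
  have triv {ψ : Fm} {e : ℕ → ℕ} (hψ : ¬ ψ.Free n) :
      (ψ.subst n t).Sat X e ↔ ψ.Sat X (Function.update e n (t.val e)) := by
    rw [Fm.subst_of_not_free t hψ]
    refine Fm.sat_congr fun m hm => (Function.update_of_ne ?_ _ _).symm
    rintro rfl
    exact hψ hm
  -- Otherwise the bound variable differs from `vₙ` and does not occur in `t`.
  have under {m : ℕ} (hm : m ≠ n) (ht : ¬ t.Occ m) (e : ℕ → ℕ) (k : ℕ) :
      Function.update (Function.update e m k) n (t.val (Function.update e m k)) =
        Function.update (Function.update e n (t.val e)) m k := by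
    rw [Function.update_comm hm]
    congr 2
    refine Tm.val_congr fun j hj => Function.update_of_ne ?_ _ _
    rintro rfl
    exact ht hj
  induction φ generalizing e with
  | eq r s => simp [Fm.subst, Fm.Sat, Tm.val_subst]
  | tr s => simp [Fm.subst, Fm.Sat, Tm.val_subst]
  | neg φ ih => exact not_congr (ih h e)
  | or φ ψ ih₁ ih₂ => exact or_congr (ih₁ h.1 e) (ih₂ h.2 e)
  | and φ ψ ih₁ ih₂ => exact and_congr (ih₁ h.1 e) (ih₂ h.2 e)
  | all m φ ih =>
    by_cases hf : (Fm.all m φ).Free n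
    · obtain ⟨ht, hφ⟩ := h.resolve_left (not_not_intro hf)
      simp only [Fm.subst, if_neg hf.1, Fm.Sat]
      exact forall_congr' fun k => (ih hφ _).trans (by rw [under hf.1 ht])
    · exact triv hf
  | ex m φ ih =>
    by_cases hf : (Fm.ex m φ).Free n
    · obtain ⟨ht, hφ⟩ := h.resolve_left (not_not_intro hf)
      simp only [Fm.subst, if_neg hf.1, Fm.Sat]
      exact exists_congr fun k => (ih hφ _).trans (by rw [under hf.1 ht])
    · exact triv hf

theorem sat_update_of_not_free {X : Set ℕ} {φ : Fm} {n : ℕ} (h : ¬ φ.Free n) (e : ℕ → ℕ) (k : ℕ) :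
    φ.Sat X (Function.update e n k) ↔ φ.Sat X e := by
  refine Fm.sat_congr fun m hm => Function.update_of_ne ?_ _ _
  rintro rfl
  exact h hm

theorem models_alls {X : Set ℕ} {φ : Fm} (vs : List ℕ) (h : Models X φ) :
    Models X (Fm.alls vs φ) := by
  induction vs with
  | nil => exact h
  | cons v vs ih => exact fun e k => ih _

theorem LogAx.models {X : Set ℕ} {φ : Fm} (h : LogAx φ) : Models X φ := by
  intro e
  cases h with
  | allDist n a b => simp only [Fm.sat_imp, Fm.Sat]; exact fun h₁ h₂ m => h₁ m (h₂ m)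
  | allVac n a h =>
    simp only [Fm.sat_imp, Fm.Sat]
    exact fun ha m => (sat_update_of_not_free h e m).2 ha
  | allInst n a t h =>
    simp only [Fm.sat_imp, Fm.Sat, Fm.sat_subst h]
    exact fun ha => ha _
  | exIntro n a t h =>
    simp only [Fm.sat_imp, Fm.Sat, Fm.sat_subst h]
    exact fun ha => ⟨_, ha⟩
  | exElim n a b h =>
    simp only [Fm.sat_imp, Fm.Sat]
    exact fun hab ⟨m, hm⟩ => (sat_update_of_not_free h e m).1 (hab m hm)
  | eqRefl t => exact rfl
  | eqSubst n a s t hs ht =>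
    simp only [Fm.sat_imp, Fm.Sat, Fm.sat_subst hs, Fm.sat_subst ht]
    exact fun hst ha => hst ▸ ha
  | _ => simp only [Fm.sat_imp, Fm.Sat]; tauto

theorem Proves.models {X : Set ℕ} {T : Set Fm} (hT : ∀ φ ∈ T, Models X φ) {φ : Fm}
    (h : Proves T φ) : Models X φ := by
  induction h with
  | hyp h => exact hT _ h
  | logic h =>
    obtain ⟨vs, ψ, hψ, rfl⟩ := h
    exact models_alls vs hψ.models
  | mp _ _ ih₁ ih₂ => exact fun e => Fm.sat_imp.1 (ih₁ e) (ih₂ e)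

theorem consistent_of_models {X : Set ℕ} {T : Set Fm} (hT : ∀ φ ∈ T, Models X φ) :
    Consistent T := by
  rintro ⟨φ, h₁, h₂⟩
  exact h₂.models hT (fun _ => 0) (h₁.models hT _)

theorem indF_models {X : Set ℕ} (n : ℕ) (φ : Fm) : Models X (indF n φ) := by
  intro e
  have h0 : φ.FreeFor n zeroT := Fm.freeFor_of_closed (closed_numeral 0) n φ
  have hS : φ.FreeFor n (succT (V n)) := Fm.freeFor_of_occ_only (by
    rintro m ⟨i, hi⟩
    rw [Subsingleton.elim i 0] at hi
    exact Eq.symm hi) φ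
  simp only [indF, Fm.sat_imp, Fm.Sat, Fm.sat_subst h0, Fm.sat_subst hS]
  rintro ⟨hz, hs⟩ k
  induction k with
  | zero => exact hz
  | succ k ih =>
    have := hs k ih
    rw [Function.update_idem] at this
    simpa [succT, V, Tm.val, Fn.interp] using this

/-! ### Derivability and maximally consistent sets -/

namespace Proves

variable {T U : Set Fm} {φ ψ χ : Fm}

theorem ax (h : LogAx φ) : Proves T φ := .logic ⟨[], φ, h, rfl⟩

theorem mono (hTU : T ⊆ U) (h : Proves T φ) : Proves U φ := by
  induction h with
  | hyp h => exact .hyp (hTU h)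
  | logic h => exact .logic h
  | mp _ _ ih₁ ih₂ => exact .mp ih₁ ih₂

theorem weaken (φ : Fm) (h : Proves T ψ) : Proves T (φ.imp ψ) := .mp (.ax (.k _ _)) h

theorem deduction (h : Proves (insert φ T) ψ) : Proves T (φ.imp ψ) := by
  induction h with
  | hyp h =>
    rcases h with rfl | h
    · exact .mp (.mp (.ax (.s _ _ _)) (.ax (.k _ _))) (.ax (.k _ (ψ.imp ψ)))
    · exact (Proves.hyp h).weaken _
  | logic h => exact (Proves.logic h).weaken _
  | mp _ _ ih₁ ih₂ => exact .mp (.mp (.ax (.s _ _ _)) ih₁) ih₂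

theorem exFalso (h : Proves T φ) (h' : Proves T φ.neg) (ψ : Fm) : Proves T ψ :=
  .mp (.mp (.ax (.contra _ _)) (h'.weaken _)) h

/-- Proof by contradiction. -/
theorem of_not_consistent_insert_neg (h : ¬ Consistent (insert φ.neg T)) : Proves T φ := by
  obtain ⟨χ, h₁, h₂⟩ := not_not.1 h
  -- `T` proves `¬φ → ¬θ` for the theorem `θ := χ → (χ → χ)`, hence `θ → φ`.
  exact .mp (.mp (.ax (.contra _ _)) (exFalso h₁ h₂ (Fm.neg (χ.imp (χ.imp χ)))).deduction)
    (.ax (.k _ _))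

theorem cut (h : Proves T φ) (h' : Proves (insert φ T) ψ) : Proves T ψ := .mp h'.deduction h

theorem neg_of_not_consistent_insert (h : ¬ Consistent (insert φ T)) : Proves T φ.neg := by
  obtain ⟨χ, h₁, h₂⟩ := not_not.1 h
  apply of_not_consistent_insert_neg
  have hφ : Proves (insert φ.neg.neg T) φ := by
    apply of_not_consistent_insert_neg
    exact not_not_intro ⟨φ.neg, .hyp (.inl rfl), .hyp (.inr (.inl rfl))⟩
  have sub : insert φ T ⊆ insert φ (insert φ.neg.neg T) :=
    Set.insert_subset_insert (Set.subset_insert _ _)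
  exact not_not_intro ⟨χ, hφ.cut (h₁.mono sub), hφ.cut (h₂.mono sub)⟩

/-- Derivations are finite: a derivation from the union of a chain uses one member only. -/
theorem of_sUnion {c : Set (Set Fm)} (hc : IsChain (· ⊆ ·) c) (hne : c.Nonempty)
    (h : Proves (⋃₀ c) φ) : ∃ T ∈ c, Proves T φ := by
  induction h with
  | hyp h =>
    obtain ⟨T, hT, h⟩ := h
    exact ⟨T, hT, .hyp h⟩
  | logic h => exact ⟨_, hne.some_mem, .logic h⟩
  | mp _ _ ih₁ ih₂ =>
    obtain ⟨T, hT, h₁⟩ := ih₁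
    obtain ⟨U, hU, h₂⟩ := ih₂
    rcases hc.total hT hU with hTU | hUT
    · exact ⟨U, hU, .mp (h₁.mono hTU) h₂⟩
    · exact ⟨T, hT, .mp h₁ (h₂.mono hUT)⟩

end Proves

theorem Consistent.mono {T U : Set Fm} (hTU : T ⊆ U) (hU : Consistent U) : Consistent T :=
  fun ⟨φ, h₁, h₂⟩ => hU ⟨φ, h₁.mono hTU, h₂.mono hTU⟩

theorem Consistent.sUnion {c : Set (Set Fm)} (hc : IsChain (· ⊆ ·) c) (hne : c.Nonempty)
    (h : ∀ T ∈ c, Consistent T) : Consistent (⋃₀ c) := by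
  rintro ⟨φ, h₁, h₂⟩
  obtain ⟨T, hT, h₁⟩ := h₁.of_sUnion hc hne
  obtain ⟨U, hU, h₂⟩ := h₂.of_sUnion hc hne
  rcases hc.total hT hU with hTU | hUT
  · exact h U hU ⟨φ, h₁.mono hTU, h₂⟩
  · exact h T hT ⟨φ, h₁, h₂.mono hUT⟩

theorem theoryOf_mono {X Y : Set ℕ} (h : X ⊆ Y) : theoryOf X ⊆ theoryOf Y :=
  fun _ hφ => ⟨hφ.1, h hφ.2⟩

theorem theoryOf_insert {φ : Fm} (h : φ.IsSentence) (X : Set ℕ) :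
    theoryOf (insert φ.code X) = insert φ (theoryOf X) := by
  ext ψ
  simp only [theoryOf, Set.mem_ofPred_eq, Set.mem_insert_iff, Fm.code_inj]
  constructor
  · rintro ⟨h₁, h₂ | h₂⟩
    · exact .inl h₂
    · exact .inr ⟨h₁, h₂⟩
  · rintro (rfl | h₁)
    · exact ⟨h, .inl rfl⟩
    · exact ⟨h₁.1, .inr h₁.2⟩

theorem code_mem_sentCodes {φ : Fm} : φ.code ∈ sentCodes ↔ φ.IsSentence :=
  ⟨fun ⟨_, h, e⟩ => Fm.code_injective e ▸ h, fun h => ⟨φ, h, rfl⟩⟩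

theorem consistent_theoryOf_sUnion {c : Set (Set ℕ)} (hc : IsChain (· ⊆ ·) c) (hne : c.Nonempty)
    (h : ∀ X ∈ c, Consistent (theoryOf X)) : Consistent (theoryOf (⋃₀ c)) := by
  have e : theoryOf (⋃₀ c) ⊆ ⋃₀ (theoryOf '' c) := by
    rintro φ ⟨h₁, X, hX, h₂⟩
    exact ⟨_, ⟨X, hX, rfl⟩, h₁, h₂⟩
  refine Consistent.mono e (Consistent.sUnion ?_ (hne.image _) ?_)
  · rintro _ ⟨X, hX, rfl⟩ _ ⟨Y, hY, rfl⟩ -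
    exact (hc.total hX hY).imp theoryOf_mono theoryOf_mono
  · rintro _ ⟨X, hX, rfl⟩
    exact h X hX

/-- Lindenbaum's lemma. -/
theorem exists_MCX_superset {X : Set ℕ} (hX : X ⊆ sentCodes) (h : Consistent (theoryOf X)) :
    ∃ X', X ⊆ X' ∧ MCX X' := by
  obtain ⟨M, hXM, hM⟩ := zorn_subset_nonempty
    {Y : Set ℕ | Y ⊆ sentCodes ∧ Consistent (theoryOf Y)}
    (fun c hc hch hne => ⟨⋃₀ c,
      ⟨Set.sUnion_subset fun Y hY => (hc hY).1,
        consistent_theoryOf_sUnion hch hne fun Y hY => (hc hY).2⟩,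
      fun Y hY => Set.subset_sUnion_of_mem hY⟩) X ⟨hX, h⟩
  exact ⟨M, hXM, hM.prop.1, hM.prop.2, fun Y h₁ h₂ h₃ =>
    (hM.le_of_ge ⟨h₁, h₂⟩ h₃).antisymm h₃⟩

namespace MCX

variable {X : Set ℕ} {φ ψ : Fm}

theorem mem_of_consistent (hX : MCX X) (hφ : φ.IsSentence)
    (h : Consistent (insert φ (theoryOf X))) : φ.code ∈ X := by
  have := hX.2.2 (insert φ.code X)
    (Set.insert_subset (code_mem_sentCodes.2 hφ) hX.1) (by rwa [theoryOf_insert hφ])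
    (Set.subset_insert _ _)
  rw [← this]
  exact Set.mem_insert _ _

theorem mem_of_proves (hX : MCX X) (hφ : φ.IsSentence) (h : Proves (theoryOf X) φ) :
    φ.code ∈ X :=
  hX.mem_of_consistent hφ fun ⟨χ, h₁, h₂⟩ => hX.2.1 ⟨χ, h.cut h₁, h.cut h₂⟩

theorem neg_mem_iff (hX : MCX X) (hφ : φ.IsSentence) : φ.neg.code ∈ X ↔ φ.code ∉ X := by
  constructor
  · exact fun h h' => hX.2.1 ⟨φ, .hyp ⟨hφ, h'⟩, .hyp ⟨hφ, h⟩⟩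
  · intro h
    refine hX.mem_of_proves hφ (Proves.neg_of_not_consistent_insert fun hc => h ?_)
    exact hX.mem_of_consistent hφ hc

end MCX

/-! ### Semantics of the arithmetized syntax -/

/-- `v` codes a variable that is free in the term or formula coded by `x`. -/
def FreeCode (x v : ℕ) : Prop :=
  ∃ n, varCode n = v ∧ ((∃ t : Tm, t.code = x ∧ t.Occ n) ∨ ∃ φ : Fm, φ.code = x ∧ φ.Free n)

/-- `t` codes a term that is free in the formula coded by `x` for the variable coded by `v`. -/
def FreeForCode (x t v : ℕ) : Prop :=
  ∃ (φ : Fm) (s : Tm) (n : ℕ), φ.code = x ∧ s.code = t ∧ varCode n = v ∧ φ.FreeFor n s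

theorem freeCode_tm {t : Tm} {v : ℕ} : FreeCode t.code v ↔ ∃ n, varCode n = v ∧ t.Occ n := by
  simp only [FreeCode, Tm.code_inj, fun φ : Fm => (Tm.code_ne_code t φ).symm, exists_eq_left,
    false_and, exists_false, or_false]

theorem freeCode_fm {φ : Fm} {v : ℕ} : FreeCode φ.code v ↔ ∃ n, varCode n = v ∧ φ.Free n := by
  simp only [FreeCode, Fm.code_inj, fun t : Tm => Tm.code_ne_code t φ, exists_eq_left,
    false_and, exists_false, false_or]

theorem freeCode_fm_varCode {φ : Fm} {n : ℕ} : FreeCode φ.code (varCode n) ↔ φ.Free n := by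
  simp [freeCode_fm, varCode_inj]

theorem freeCode_tm_varCode {t : Tm} {n : ℕ} : FreeCode t.code (varCode n) ↔ t.Occ n := by
  simp [freeCode_tm, varCode_inj]

theorem freeForCode_code {φ : Fm} {t : Tm} {n : ℕ} :
    FreeForCode φ.code t.code (varCode n) ↔ φ.FreeFor n t := by
  simp [FreeForCode, Fm.code_inj, Tm.code_inj, varCode_inj]

open Classical in
/-- The value at `p` of a characteristic function: `1` if `p` holds and `0` otherwise. -/
noncomputable def charVal (p : Prop) : ℕ := if p then 1 else 0

@[simp] theorem charVal_eq_one {p : Prop} : charVal p = 1 ↔ p := by simp [charVal]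

@[simp] theorem charVal_eq_zero {p : Prop} : charVal p = 0 ↔ ¬ p := by simp [charVal]

@[simp] theorem charVal_mul {p q : Prop} : charVal p * charVal q = charVal (p ∧ q) := by
  by_cases p <;> by_cases q <;> simp [charVal, *]

@[simp] theorem charVal_inj {p q : Prop} : charVal p = charVal q ↔ (p ↔ q) := by
  by_cases p <;> by_cases q <;> simp [charVal, *]

section Values

variable (e : ℕ → ℕ) (s t r : Tm)

@[simp] theorem val_V (n : ℕ) : (V n).val e = e n := rfl
@[simp] theorem val_zeroT : zeroT.val e = 0 := rfl
@[simp] theorem val_succT : (succT s).val e = s.val e + 1 := rfl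
@[simp] theorem val_oneT : oneT.val e = 1 := rfl
@[simp] theorem val_plusT : (plusT s t).val e = s.val e + t.val e := rfl
@[simp] theorem val_timesT : (timesT s t).val e = s.val e * t.val e := rfl
@[simp] theorem val_prT : (prT s t).val e = Nat.pair (s.val e) (t.val e) := rfl
@[simp] theorem val_dEqT : (dEqT s t).val e = node 2 [s.val e, t.val e] := rfl
@[simp] theorem val_dNegT : (dNegT s).val e = node 4 [s.val e] := rfl
@[simp] theorem val_dOrT : (dOrT s t).val e = node 5 [s.val e, t.val e] := rfl
@[simp] theorem val_dAndT : (dAndT s t).val e = node 6 [s.val e, t.val e] := rfl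
@[simp] theorem val_dImpT : (dImpT s t).val e = node 5 [node 4 [s.val e], t.val e] := rfl
@[simp] theorem val_dAllT : (dAllT s t).val e = node 7 [s.val e, t.val e] := rfl
@[simp] theorem val_dExT : (dExT s t).val e = node 8 [s.val e, t.val e] := rfl
@[simp] theorem val_numT : (numT s).val e = (numeral (s.val e)).code := rfl
@[simp] theorem val_subT : (subT s t r).val e = subCode (s.val e) (t.val e) (r.val e) := rfl
@[simp] theorem val_genT : (genT s t).val e =
    (Denumerable.ofNat (List ℕ) (s.val e)).foldr (fun v x => node 7 [v, x]) (t.val e) := rfl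

@[simp] theorem val_tmT : (tmT s).val e = charVal (IsTmCode (s.val e)) := rfl

@[simp] theorem val_fmT : (fmT s).val e = charVal (IsFmCode (s.val e)) := rfl

@[simp] theorem val_fvT : (fvT s t).val e = charVal (FreeCode (s.val e) (t.val e)) := rfl

@[simp] theorem val_ffT :
    (ffT s t r).val e = charVal (FreeForCode (s.val e) (t.val e) (r.val e)) := rfl

@[simp] theorem val_memT : (memT s t).val e =
    charVal (s.val e ∈ Denumerable.ofNat (List ℕ) (t.val e)) := by
  change ite (s.val e ∈ Denumerable.ofNat (List ℕ) (t.val e)) 1 0 = _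
  unfold charVal
  congr

@[simp] theorem val_numeral (n : ℕ) : (numeral n).val e = n := by
  induction n with
  | zero => rfl
  | succ n ih => exact congrArg (· + 1) ih

@[simp] theorem val_nodeT (q : ℕ) (ts : List Tm) :
    (nodeT q ts).val e = node q (ts.map (Tm.val e)) := by
  simp only [nodeT, node, val_prT, val_numeral]
  congr 1
  induction ts with
  | nil => rfl
  | cons t ts ih => simp [ih]

@[simp] theorem val_prodT (ts : List Tm) : (prodT ts).val e = (ts.map (Tm.val e)).prod := by
  induction ts with
  | nil => rfl
  | cons t ts ih =>
    rw [List.map_cons, List.prod_cons, ← ih]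
    rfl

@[simp] theorem val_quoteT (φ : Fm) : (quoteT φ).val e = φ.code := val_numeral e _

@[simp] theorem val_dotT (φ : Fm) : (dotT φ s).val e = (φ.subst 0 (numeral (s.val e))).code := by
  simp [dotT, subCode_fm]

end Values

@[simp] theorem occ_V {m n : ℕ} : (V m).Occ n ↔ m = n := Iff.rfl

section Satisfaction

variable {X : Set ℕ} {e : ℕ → ℕ}

@[simp] theorem sat_disjF {φs : List Fm} : (disjF φs).Sat X e ↔ ∃ φ ∈ φs, φ.Sat X e := by
  induction φs with
  | nil => simp [disjF, botF, Fm.Sat]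
  | cons φ φs ih =>
    rw [List.exists_mem_cons_iff, ← ih]
    rfl

@[simp] theorem sat_conjF {φs : List Fm} : (conjF φs).Sat X e ↔ ∀ φ ∈ φs, φ.Sat X e := by
  induction φs with
  | nil => simp [conjF, topF, Fm.Sat]
  | cons φ φs ih =>
    rw [List.forall_mem_cons, ← ih]
    rfl

@[simp] theorem sat_isTmF {t : Tm} : (isTmF t).Sat X e ↔ IsTmCode (t.val e) := by
  simp [isTmF, Fm.Sat]

@[simp] theorem sat_isFmF {t : Tm} : (isFmF t).Sat X e ↔ IsFmCode (t.val e) := by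
  simp [isFmF, Fm.Sat]

@[simp] theorem sat_isExprF {t : Tm} :
    (isExprF t).Sat X e ↔ IsTmCode (t.val e) ∨ IsFmCode (t.val e) := by
  simp [isExprF, Fm.Sat]

@[simp] theorem sat_freeF {t v : Tm} : (freeF t v).Sat X e ↔ FreeCode (t.val e) (v.val e) := by
  simp [freeF, Fm.Sat]

@[simp] theorem sat_freeForF {x t v : Tm} :
    (freeForF x t v).Sat X e ↔ FreeForCode (x.val e) (t.val e) (v.val e) := by
  simp [freeForF, Fm.Sat]

theorem val_update_of_not_occ {t : Tm} {n : ℕ} (h : ¬ t.Occ n) (e : ℕ → ℕ) (k : ℕ) :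
    t.val (Function.update e n k) = t.val e := by
  refine Tm.val_congr fun m hm => Function.update_of_ne ?_ _ _
  rintro rfl
  exact h hm

@[simp] theorem sat_isVarF {t : Tm} (ht : ¬ t.Occ 90) :
    (isVarF t).Sat X e ↔ ∃ n, t.val e = varCode n := by
  simp [isVarF, Fm.Sat, val_update_of_not_occ ht, varCode]

@[simp] theorem sat_ltF {s t : Tm} (hs : ¬ s.Occ 92) (ht : ¬ t.Occ 92) :
    (ltF s t).Sat X e ↔ s.val e < t.val e := by
  simp only [ltF, Fm.Sat, val_plusT, val_succT, val_V, val_update_of_not_occ hs,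
    val_update_of_not_occ ht, Function.update_self]
  constructor
  · rintro ⟨m, hm⟩
    omega
  · exact fun h => ⟨t.val e - s.val e - 1, by omega⟩

@[simp] theorem sat_CTF {t : Tm} (ht : ¬ t.Occ 91) :
    (CTF t).Sat X e ↔ ∃ u : Tm, u.code = t.val e ∧ u.Closed := by
  simp only [CTF, Fm.Sat, sat_isTmF, sat_freeF, val_update_of_not_occ ht, val_V,
    Function.update_self]
  constructor
  · rintro ⟨⟨u, hu⟩, h⟩
    refine ⟨u, hu, fun n hn => h (varCode n) ?_⟩
    rwa [← hu, freeCode_tm_varCode]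
  · rintro ⟨u, hu, h⟩
    refine ⟨⟨u, hu⟩, fun m => ?_⟩
    rw [← hu, freeCode_tm]
    rintro ⟨n, -, hn⟩
    exact h n hn

@[simp] theorem sat_SentF {t : Tm} (ht : ¬ t.Occ 91) :
    (SentF t).Sat X e ↔ t.val e ∈ sentCodes := by
  simp only [SentF, Fm.Sat, sat_isFmF, sat_freeF, val_update_of_not_occ ht, val_V,
    Function.update_self]
  constructor
  · rintro ⟨⟨φ, hφ⟩, h⟩
    refine ⟨φ, fun n hn => h (varCode n) ?_, hφ⟩
    rwa [← hφ, freeCode_fm_varCode]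
  · rintro ⟨φ, h, hφ⟩
    refine ⟨⟨φ, hφ⟩, fun m => ?_⟩
    rw [← hφ, freeCode_fm]
    rintro ⟨n, -, hn⟩
    exact h n hn

end Satisfaction

theorem models_all {X : Set ℕ} {φ : Fm} (n : ℕ) (h : Models X φ) : Models X (Fm.all n φ) :=
  models_alls [n] h

/-- The block `∃vₘ … ∃vₘ₊ₖ₋₁` asks for a `k`-tuple of values. -/
theorem sat_exs_range {X : Set ℕ} (m k : ℕ) (φ : Fm) (e : ℕ → ℕ) :
    (Fm.exs ((List.range k).map (m + ·)) φ).Sat X e ↔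
      ∃ a : ℕ → ℕ, φ.Sat X fun n => if m ≤ n ∧ n < m + k then a n else e n := by
  have gen (vs : List ℕ) : ∀ e, (Fm.exs vs φ).Sat X e ↔
      ∃ a : ℕ → ℕ, φ.Sat X fun n => if n ∈ vs then a n else e n := by
    induction vs with
    | nil => simp [Fm.exs]
    | cons v vs ih =>
      intro e
      change (∃ b, (Fm.exs vs φ).Sat X _) ↔ _
      constructor
      · rintro ⟨b, h⟩
        obtain ⟨a, h⟩ := (ih _).1 h
        refine ⟨fun n => if n ∈ vs then a n else b, ?_⟩
        convert h using 2 with n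
        by_cases hn : n ∈ vs
        · simp [hn]
        · by_cases hv : n = v <;> simp [hn, hv]
      · rintro ⟨a, h⟩
        refine ⟨a v, (ih _).2 ⟨a, ?_⟩⟩
        convert h using 2 with n
        by_cases hn : n ∈ vs
        · simp [hn]
        · by_cases hv : n = v <;> simp [hn, hv]
  rw [gen]
  refine exists_congr fun a => ?_
  have (n : ℕ) : n ∈ (List.range k).map (m + ·) ↔ m ≤ n ∧ n < m + k := by
    simp only [List.mem_map, List.mem_range]
    constructor
    · rintro ⟨i, hi, rfl⟩
      omega
    · exact fun h => ⟨n - m, by omega, by omega⟩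
  simp only [this]

/-! ### The standard model satisfies PAT -/

theorem models_arithAx (X : Set ℕ) : ∀ φ ∈ arithAx, Models X φ := by
  simp only [arithAx, List.forall_mem_cons, List.not_mem_nil, false_imp_iff, implies_true, and_true]
  refine ⟨models_all _ ?_, models_alls _ ?_, models_all _ ?_, models_alls _ ?_, models_all _ ?_,
    models_alls _ ?_⟩ <;> intro e <;> simp [Fm.Sat, Fm.sat_imp]
  · omega
  · ring

theorem models_basicDefAx (X : Set ℕ) : ∀ φ ∈ basicDefAx, Models X φ := by
  simp only [basicDefAx, List.forall_mem_cons, List.not_mem_nil, false_imp_iff, implies_true,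
    and_true]
  refine ⟨models_alls _ ?_, models_alls _ ?_, models_alls _ ?_, models_all _ ?_, models_alls _ ?_,
    models_alls _ ?_, models_alls _ ?_, models_alls _ ?_, ?_, models_all _ ?_, models_all _ ?_,
    models_alls _ ?_, models_alls _ ?_, models_all _ ?_, models_alls _ ?_⟩ <;>
    intro e <;> simp [Fm.Sat, Fm.sat_imp, numeral, Tm.code]
  · exact fun h => if_pos h
  · exact fun h => if_neg h.not_gt
  · exact fun h h' => absurd h' h

theorem not_isTmCode_node {q : ℕ} {xs : List ℕ} (h₂ : 2 ≤ q) (h₈ : q < 10) :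
    ¬ IsTmCode (node q xs) := by
  rintro ⟨t, ht⟩
  have := t.code_tag
  rw [ht] at this
  simp only [node, Nat.unpair_pair] at this
  omega

theorem not_isFmCode_node {k : ℕ} (f : Fn k) (xs : List ℕ) : ¬ IsFmCode (node f.tag xs) :=
  fun ⟨φ, h⟩ => φ.code_ne_node_tag f xs h

theorem isFmCode_node_eq {x y : ℕ} : IsFmCode (node 2 [x, y]) ↔ IsTmCode x ∧ IsTmCode y := by
  constructor
  · rintro ⟨φ, h⟩
    obtain ⟨s, t, -, hs, ht⟩ := φ.eq_of_code_eq h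
    exact ⟨⟨s, hs⟩, t, ht⟩
  · rintro ⟨⟨s, rfl⟩, t, rfl⟩
    exact ⟨.eq s t, rfl⟩

theorem isFmCode_node_tr {x : ℕ} : IsFmCode (node 3 [x]) ↔ IsTmCode x := by
  constructor
  · rintro ⟨φ, h⟩
    obtain ⟨t, -, ht⟩ := φ.eq_of_code_tr h
    exact ⟨t, ht⟩
  · rintro ⟨t, rfl⟩
    exact ⟨.tr t, rfl⟩

theorem isFmCode_node_neg {x : ℕ} : IsFmCode (node 4 [x]) ↔ IsFmCode x := by
  constructor
  · rintro ⟨φ, h⟩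
    obtain ⟨ψ, -, hψ⟩ := φ.eq_of_code_neg h
    exact ⟨ψ, hψ⟩
  · rintro ⟨ψ, rfl⟩
    exact ⟨.neg ψ, rfl⟩

theorem isFmCode_node_or {x y : ℕ} : IsFmCode (node 5 [x, y]) ↔ IsFmCode x ∧ IsFmCode y := by
  constructor
  · rintro ⟨φ, h⟩
    obtain ⟨s, t, -, hs, ht⟩ := φ.eq_of_code_or h
    exact ⟨⟨s, hs⟩, t, ht⟩
  · rintro ⟨⟨s, rfl⟩, t, rfl⟩
    exact ⟨.or s t, rfl⟩

theorem isFmCode_node_and {x y : ℕ} : IsFmCode (node 6 [x, y]) ↔ IsFmCode x ∧ IsFmCode y := by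
  constructor
  · rintro ⟨φ, h⟩
    obtain ⟨s, t, -, hs, ht⟩ := φ.eq_of_code_and h
    exact ⟨⟨s, hs⟩, t, ht⟩
  · rintro ⟨⟨s, rfl⟩, t, rfl⟩
    exact ⟨.and s t, rfl⟩

theorem isFmCode_node_all {x y : ℕ} :
    IsFmCode (node 7 [x, y]) ↔ (∃ n, x = varCode n) ∧ IsFmCode y := by
  constructor
  · rintro ⟨φ, h⟩
    obtain ⟨n, ψ, -, hn, hψ⟩ := φ.eq_of_code_all h
    exact ⟨⟨n, hn.symm⟩, ψ, hψ⟩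
  · rintro ⟨⟨n, rfl⟩, ψ, rfl⟩
    exact ⟨.all n ψ, rfl⟩

theorem isFmCode_node_ex {x y : ℕ} :
    IsFmCode (node 8 [x, y]) ↔ (∃ n, x = varCode n) ∧ IsFmCode y := by
  constructor
  · rintro ⟨φ, h⟩
    obtain ⟨n, ψ, -, hn, hψ⟩ := φ.eq_of_code_ex h
    exact ⟨⟨n, hn.symm⟩, ψ, hψ⟩
  · rintro ⟨⟨n, rfl⟩, ψ, rfl⟩
    exact ⟨.ex n ψ, rfl⟩

theorem charVal_prod {k : ℕ} (p : Fin k → Prop) :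
    (List.ofFn fun i => charVal (p i)).prod = charVal (∀ i, p i) := by
  classical
  simp [List.prod_ofFn, charVal, Finset.prod_boole]

theorem models_tmAx (X : Set ℕ) : ∀ φ ∈ tmAx, Models X φ := by
  simp only [tmAx, List.forall_mem_append, List.forall_mem_cons, List.forall_mem_map,
    List.not_mem_nil, false_imp_iff, implies_true, and_true]
  refine ⟨⟨models_all _ fun e => ?_, models_all _ fun e => ?_⟩,
    fun ⟨k, f⟩ _ => models_alls _ fun e => ?_⟩
  · simp only [Fm.Sat, val_tmT, val_prT, val_numeral, val_V, val_oneT, charVal_eq_one]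
    exact isTmCode_varCode (e 0)
  · simp only [Fm.sat_imp, sat_conjF, List.forall_mem_cons, List.forall_mem_map, Fm.Sat, val_V,
      val_zeroT, val_tmT]
    rintro ⟨hv, hf⟩
    refine charVal_eq_zero.2 fun ⟨t, ht⟩ => ?_
    cases t with
    | var n => exact hv (by simpa using ⟨n, ht.symm⟩)
    | @app k f ts =>
      refine hf ⟨_, f⟩ f.mem_all ?_
      have := sat_exs_range (X := X) 0 k
        (.eq (V 9) (nodeT f.tag (List.ofFn fun i : Fin k => V i))) e
      simp only [Nat.zero_add, List.map_id'] at this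
      rw [this]
      refine ⟨fun n => if h : n < k then (ts ⟨n, h⟩).code else 0, ?_⟩
      have := f.arity_le
      simp only [Fm.Sat, val_nodeT, List.map_ofFn, val_V]
      rw [if_neg (by omega), ← ht, Tm.code]
      congr 2
      ext i
      simp
  · simp only [Fm.Sat, val_tmT, val_nodeT, val_prodT, List.map_ofFn]
    exact (charVal_inj.2 (isTmCode_node f _)).trans (charVal_prod _).symm

theorem models_fmAx (X : Set ℕ) : ∀ φ ∈ fmAx, Models X φ := by
  simp only [fmAx, List.forall_mem_cons, List.not_mem_nil, false_imp_iff, implies_true, and_true]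
  refine ⟨models_alls _ ?_, models_all _ ?_, models_all _ ?_, models_alls _ ?_, models_alls _ ?_,
    models_alls _ ?_, models_alls _ ?_, models_alls _ ?_, models_alls _ ?_, models_all _ ?_⟩ <;>
    intro e
  · simp [Fm.Sat, isFmCode_node_eq]
  · simp [Fm.Sat, isFmCode_node_tr]
  · simp [Fm.Sat, isFmCode_node_neg]
  · simp [Fm.Sat, isFmCode_node_or]
  · simp [Fm.Sat, isFmCode_node_and]
  · simp [Fm.sat_imp, Fm.Sat, isFmCode_node_all]
    tauto
  · simp [Fm.sat_imp, Fm.Sat, isFmCode_node_all]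
    tauto
  · simp [Fm.sat_imp, Fm.Sat, isFmCode_node_ex]
    tauto
  · simp [Fm.sat_imp, Fm.Sat, isFmCode_node_ex]
    tauto
  · simp [Fm.sat_imp, Fm.Sat, Fm.exs]
    rintro h₂ h₃ h₄ h₅ h₆ h₇ h₈ ⟨φ, hφ⟩
    cases φ with
    | eq s t => exact h₂ _ _ hφ.symm
    | tr t => exact h₃ _ hφ.symm
    | neg φ => exact h₄ _ hφ.symm
    | or φ ψ => exact h₅ _ _ hφ.symm
    | and φ ψ => exact h₆ _ _ hφ.symm
    | all n φ => exact h₇ _ _ hφ.symm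
    | ex n φ => exact h₈ _ _ hφ.symm

/-! ### Free variables on codes -/

theorem freeCode_node {k : ℕ} {f : Fn k} {a : Fin k → ℕ} {v : ℕ}
    (h : IsTmCode (node f.tag (List.ofFn a))) :
    FreeCode (node f.tag (List.ofFn a)) v ↔ ∃ i, FreeCode (a i) v := by
  obtain ⟨t, ht⟩ := h
  obtain ⟨ts, rfl, hts⟩ := Tm.eq_app_of_code ht
  rw [← ht, freeCode_tm]
  simp only [← hts, freeCode_tm, Tm.Occ]
  constructor
  · rintro ⟨n, hn, i, hi⟩
    exact ⟨i, n, hn, hi⟩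
  · rintro ⟨i, n, hn, hi⟩
    exact ⟨n, hn, i, hi⟩

theorem freeCode_node_eq {x y v : ℕ} (h : IsFmCode (node 2 [x, y])) :
    FreeCode (node 2 [x, y]) v ↔ FreeCode x v ∨ FreeCode y v := by
  obtain ⟨φ, h⟩ := h
  obtain ⟨s, t, rfl, rfl, rfl⟩ := φ.eq_of_code_eq h
  simp only [← h, freeCode_fm, freeCode_tm, Fm.Free, and_or_left, exists_or]

theorem freeCode_node_tr {x v : ℕ} (h : IsFmCode (node 3 [x])) :
    FreeCode (node 3 [x]) v ↔ FreeCode x v := by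
  obtain ⟨φ, h⟩ := h
  obtain ⟨t, rfl, rfl⟩ := φ.eq_of_code_tr h
  simp only [← h, freeCode_fm, freeCode_tm, Fm.Free]

theorem freeCode_node_neg {x v : ℕ} (h : IsFmCode (node 4 [x])) :
    FreeCode (node 4 [x]) v ↔ FreeCode x v := by
  obtain ⟨φ, h⟩ := h
  obtain ⟨t, rfl, rfl⟩ := φ.eq_of_code_neg h
  simp only [← h, freeCode_fm, Fm.Free]

theorem freeCode_node_or {x y v : ℕ} (h : IsFmCode (node 5 [x, y])) :
    FreeCode (node 5 [x, y]) v ↔ FreeCode x v ∨ FreeCode y v := by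
  obtain ⟨φ, h⟩ := h
  obtain ⟨s, t, rfl, rfl, rfl⟩ := φ.eq_of_code_or h
  simp only [← h, freeCode_fm, Fm.Free, and_or_left, exists_or]

theorem freeCode_node_and {x y v : ℕ} (h : IsFmCode (node 6 [x, y])) :
    FreeCode (node 6 [x, y]) v ↔ FreeCode x v ∨ FreeCode y v := by
  obtain ⟨φ, h⟩ := h
  obtain ⟨s, t, rfl, rfl, rfl⟩ := φ.eq_of_code_and h
  simp only [← h, freeCode_fm, Fm.Free, and_or_left, exists_or]

/-- The side condition on bound variables, read on codes of variables. -/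
theorem exists_varCode_ne {P : ℕ → Prop} {m v : ℕ} :
    (∃ n, varCode n = v ∧ m ≠ n ∧ P n) ↔ varCode m ≠ v ∧ ∃ n, varCode n = v ∧ P n := by
  constructor
  · rintro ⟨n, rfl, h, hn⟩
    exact ⟨fun h' => h (varCode_inj.1 h'), n, rfl, hn⟩
  · rintro ⟨h, n, rfl, hn⟩
    exact ⟨n, rfl, fun h' => h (varCode_inj.2 h'), hn⟩

theorem freeCode_node_all {x y v : ℕ} (h : IsFmCode (node 7 [x, y])) :
    FreeCode (node 7 [x, y]) v ↔ x ≠ v ∧ FreeCode y v := by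
  obtain ⟨φ, h⟩ := h
  obtain ⟨n, ψ, rfl, rfl, rfl⟩ := φ.eq_of_code_all h
  simp only [← h, freeCode_fm, Fm.Free, exists_varCode_ne]

theorem freeCode_node_ex {x y v : ℕ} (h : IsFmCode (node 8 [x, y])) :
    FreeCode (node 8 [x, y]) v ↔ x ≠ v ∧ FreeCode y v := by
  obtain ⟨φ, h⟩ := h
  obtain ⟨n, ψ, rfl, rfl, rfl⟩ := φ.eq_of_code_ex h
  simp only [← h, freeCode_fm, Fm.Free, exists_varCode_ne]

theorem varsT_eq_ofFn (k : ℕ) : varsT k = List.ofFn fun i : Fin k => V i := by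
  simp [varsT, List.ofFn_eq_map, ← List.map_coe_finRange_eq_range]

theorem models_fvAx (X : Set ℕ) : ∀ φ ∈ fvAx, Models X φ := by
  simp only [fvAx, plainTags, List.forall_mem_append, List.forall_mem_cons, List.forall_mem_map,
    List.not_mem_nil, false_imp_iff, implies_true, and_true]
  refine ⟨⟨⟨models_alls _ fun e => ?_, models_alls _ fun e => ?_, models_alls _ fun e => ?_⟩,
    fun ⟨k, f⟩ _ => models_alls _ fun e => ?_, models_alls _ fun e => ?_, models_alls _ fun e => ?_,
    models_alls _ fun e => ?_, models_alls _ fun e => ?_, models_alls _ fun e => ?_⟩,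
    models_alls _ fun e => ?_, models_alls _ fun e => ?_⟩
  · simp [Fm.Sat]
    tauto
  · simp [Fm.Sat, Fm.sat_imp]
    rintro ⟨n, hn, ⟨t, ht, -⟩ | ⟨φ, hφ, -⟩⟩
    · exact ⟨.inl ⟨t, ht⟩, n, hn.symm⟩
    · exact ⟨.inr ⟨φ, hφ⟩, n, hn.symm⟩
  · simp only [Fm.sat_iff, sat_freeF, Fm.Sat, val_prT, val_V, val_numeral]
    change FreeCode (Tm.var (e 0)).code _ ↔ _ = varCode _
    simp only [freeCode_tm, Tm.Occ]
    constructor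
    · rintro ⟨n, h, rfl⟩
      exact h.symm
    · exact fun h => ⟨_, h.symm, rfl⟩
  · simp only [Fm.sat_imp, Fm.sat_iff, sat_isExprF, sat_freeF, sat_disjF, varsT_eq_ofFn, val_nodeT,
      List.map_ofFn, not_isFmCode_node, or_false]
    intro h
    rw [freeCode_node h]
    simp [List.mem_ofFn]
  · simpa [Fm.sat_imp, Fm.sat_iff, varsT, List.range_succ, not_isTmCode_node] using freeCode_node_eq
  · simpa [Fm.sat_imp, Fm.sat_iff, varsT, List.range_succ, not_isTmCode_node] using freeCode_node_tr
  · simpa [Fm.sat_imp, Fm.sat_iff, varsT, List.range_succ, not_isTmCode_node] using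
      freeCode_node_neg
  · simpa [Fm.sat_imp, Fm.sat_iff, varsT, List.range_succ, not_isTmCode_node] using freeCode_node_or
  · simpa [Fm.sat_imp, Fm.sat_iff, varsT, List.range_succ, not_isTmCode_node] using
      freeCode_node_and
  · simpa [Fm.sat_imp, Fm.sat_iff, Fm.Sat] using freeCode_node_all
  · simpa [Fm.sat_imp, Fm.sat_iff, Fm.Sat] using freeCode_node_ex

/-! ### Substitution on codes -/

theorem subCode_node {k : ℕ} {f : Fn k} {a : Fin k → ℕ} {t v : ℕ}
    (h : IsTmCode (node f.tag (List.ofFn a))) (ht : IsTmCode t) (hv : ∃ n, v = varCode n) :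
    subCode (node f.tag (List.ofFn a)) t v = node f.tag (List.ofFn fun i => subCode (a i) t v) := by
  obtain ⟨u, hu⟩ := h
  obtain ⟨ts, rfl, hts⟩ := Tm.eq_app_of_code hu
  obtain ⟨t, rfl⟩ := ht
  obtain ⟨n, rfl⟩ := hv
  rw [← hu, subCode_tm]
  simp only [← hts, subCode_tm]
  rfl

theorem subCode_node_eq {x y t v : ℕ} (h : IsFmCode (node 2 [x, y])) (ht : IsTmCode t)
    (hv : ∃ n, v = varCode n) :
    subCode (node 2 [x, y]) t v = node 2 [subCode x t v, subCode y t v] := by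
  obtain ⟨φ, h⟩ := h
  obtain ⟨r, s, rfl, rfl, rfl⟩ := φ.eq_of_code_eq h
  obtain ⟨t, rfl⟩ := ht
  obtain ⟨n, rfl⟩ := hv
  simp only [← h, subCode_fm, subCode_tm]
  rfl

theorem subCode_node_tr {x t v : ℕ} (h : IsFmCode (node 3 [x])) (ht : IsTmCode t)
    (hv : ∃ n, v = varCode n) : subCode (node 3 [x]) t v = node 3 [subCode x t v] := by
  obtain ⟨φ, h⟩ := h
  obtain ⟨r, rfl, rfl⟩ := φ.eq_of_code_tr h
  obtain ⟨t, rfl⟩ := ht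
  obtain ⟨n, rfl⟩ := hv
  simp only [← h, subCode_fm, subCode_tm]
  rfl

theorem subCode_node_neg {x t v : ℕ} (h : IsFmCode (node 4 [x])) (ht : IsTmCode t)
    (hv : ∃ n, v = varCode n) : subCode (node 4 [x]) t v = node 4 [subCode x t v] := by
  obtain ⟨φ, h⟩ := h
  obtain ⟨ψ, rfl, rfl⟩ := φ.eq_of_code_neg h
  obtain ⟨t, rfl⟩ := ht
  obtain ⟨n, rfl⟩ := hv
  simp only [← h, subCode_fm]
  rfl

theorem subCode_node_or {x y t v : ℕ} (h : IsFmCode (node 5 [x, y])) (ht : IsTmCode t)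
    (hv : ∃ n, v = varCode n) :
    subCode (node 5 [x, y]) t v = node 5 [subCode x t v, subCode y t v] := by
  obtain ⟨φ, h⟩ := h
  obtain ⟨ψ, χ, rfl, rfl, rfl⟩ := φ.eq_of_code_or h
  obtain ⟨t, rfl⟩ := ht
  obtain ⟨n, rfl⟩ := hv
  simp only [← h, subCode_fm]
  rfl

theorem subCode_node_and {x y t v : ℕ} (h : IsFmCode (node 6 [x, y])) (ht : IsTmCode t)
    (hv : ∃ n, v = varCode n) :
    subCode (node 6 [x, y]) t v = node 6 [subCode x t v, subCode y t v] := by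
  obtain ⟨φ, h⟩ := h
  obtain ⟨ψ, χ, rfl, rfl, rfl⟩ := φ.eq_of_code_and h
  obtain ⟨t, rfl⟩ := ht
  obtain ⟨n, rfl⟩ := hv
  simp only [← h, subCode_fm]
  rfl

theorem subCode_node_all {x y t v : ℕ} (h : IsFmCode (node 7 [x, y])) (ht : IsTmCode t)
    (hv : ∃ n, v = varCode n) :
    (x = v → subCode (node 7 [x, y]) t v = node 7 [x, y]) ∧
      (x ≠ v → subCode (node 7 [x, y]) t v = node 7 [x, subCode y t v]) := by
  obtain ⟨φ, h⟩ := h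
  obtain ⟨m, ψ, rfl, rfl, rfl⟩ := φ.eq_of_code_all h
  obtain ⟨t, rfl⟩ := ht
  obtain ⟨n, rfl⟩ := hv
  rw [← h, subCode_fm, subCode_fm, Fm.subst]
  exact ⟨fun hm => by rw [if_pos (varCode_inj.1 hm)],
    fun hm => by rw [if_neg (mt varCode_inj.2 hm)]; rfl⟩

theorem subCode_node_ex {x y t v : ℕ} (h : IsFmCode (node 8 [x, y])) (ht : IsTmCode t)
    (hv : ∃ n, v = varCode n) :
    (x = v → subCode (node 8 [x, y]) t v = node 8 [x, y]) ∧
      (x ≠ v → subCode (node 8 [x, y]) t v = node 8 [x, subCode y t v]) := by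
  obtain ⟨φ, h⟩ := h
  obtain ⟨m, ψ, rfl, rfl, rfl⟩ := φ.eq_of_code_ex h
  obtain ⟨t, rfl⟩ := ht
  obtain ⟨n, rfl⟩ := hv
  rw [← h, subCode_fm, subCode_fm, Fm.subst]
  exact ⟨fun hm => by rw [if_pos (varCode_inj.1 hm)],
    fun hm => by rw [if_neg (mt varCode_inj.2 hm)]; rfl⟩

theorem models_subAx (X : Set ℕ) : ∀ φ ∈ subAx, Models X φ := by
  simp only [subAx, plainTags, List.forall_mem_append, List.forall_mem_cons, List.forall_mem_map,
    List.not_mem_nil, false_imp_iff, implies_true, and_true]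
  refine ⟨⟨⟨models_alls _ fun e => ?_, models_alls _ fun e => ?_, models_alls _ fun e => ?_⟩,
    fun ⟨k, f⟩ _ => models_alls _ fun e => ?_, models_alls _ fun e => ?_, models_alls _ fun e => ?_,
    models_alls _ fun e => ?_, models_alls _ fun e => ?_, models_alls _ fun e => ?_⟩,
    models_alls _ fun e => ?_, models_alls _ fun e => ?_⟩
  · simp only [Fm.sat_imp, Fm.Sat, sat_isExprF, sat_isTmF, val_V, val_subT, val_zeroT]
    intro h
    by_contra h0
    exact h (by simpa using of_subCode_ne_zero h0)
  · simp [Fm.sat_imp, Fm.Sat]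
    rintro ⟨t, ht⟩ n hn
    rw [hn, ← ht]
    exact (subCode_tm (.var n) t n).trans (by simp [Tm.subst])
  · simp [Fm.sat_imp, Fm.Sat]
    rintro m hm h ⟨t, ht⟩ n hn
    rw [hn, ← ht, hm]
    have hmn : m ≠ n := by
      rintro rfl
      exact h (hm.trans hn.symm)
    exact (subCode_tm (.var m) t n).trans (by simp [Tm.subst, hmn, Tm.code])
  · simp only [Fm.sat_imp, Fm.Sat, sat_isExprF, sat_isTmF, varsT_eq_ofFn, val_nodeT, val_subT,
      List.map_ofFn, not_isFmCode_node, or_false]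
    rintro ⟨h, ht, hv⟩
    rw [subCode_node h ht (by simpa using hv)]
    rfl
  · simp [Fm.sat_imp, Fm.Sat, varsT, List.range_succ, not_isTmCode_node]
    exact fun h ht n hn => subCode_node_eq h ht ⟨n, hn⟩
  · simp [Fm.sat_imp, Fm.Sat, varsT, List.range_succ, not_isTmCode_node]
    exact fun h ht n hn => subCode_node_tr h ht ⟨n, hn⟩
  · simp [Fm.sat_imp, Fm.Sat, varsT, List.range_succ, not_isTmCode_node]
    exact fun h ht n hn => subCode_node_neg h ht ⟨n, hn⟩
  · simp [Fm.sat_imp, Fm.Sat, varsT, List.range_succ, not_isTmCode_node]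
    exact fun h ht n hn => subCode_node_or h ht ⟨n, hn⟩
  · simp [Fm.sat_imp, Fm.Sat, varsT, List.range_succ, not_isTmCode_node]
    exact fun h ht n hn => subCode_node_and h ht ⟨n, hn⟩
  · simp [Fm.sat_imp, Fm.Sat]
    exact fun h ht n hn => subCode_node_all h ht ⟨n, hn⟩
  · simp [Fm.sat_imp, Fm.Sat]
    exact fun h ht n hn => subCode_node_ex h ht ⟨n, hn⟩

/-! ### Capture-free substitution on codes -/

theorem freeForCode_node_neg {x t v : ℕ} :
    FreeForCode (node 4 [x]) t v ↔ FreeForCode x t v := by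
  constructor
  · rintro ⟨φ, s, n, h, hs, hn, hf⟩
    obtain ⟨ψ, rfl, rfl⟩ := φ.eq_of_code_neg h
    exact ⟨ψ, s, n, rfl, hs, hn, hf⟩
  · rintro ⟨φ, s, n, rfl, hs, hn, hf⟩
    exact ⟨.neg φ, s, n, rfl, hs, hn, hf⟩

theorem freeForCode_node_or {x y t v : ℕ} :
    FreeForCode (node 5 [x, y]) t v ↔ FreeForCode x t v ∧ FreeForCode y t v := by
  constructor
  · rintro ⟨φ, s, n, h, hs, hn, hf⟩
    obtain ⟨ψ, χ, rfl, rfl, rfl⟩ := φ.eq_of_code_or h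
    exact ⟨⟨ψ, s, n, rfl, hs, hn, hf.1⟩, χ, s, n, rfl, hs, hn, hf.2⟩
  · rintro ⟨⟨φ, s, n, rfl, rfl, rfl, hf⟩, ψ, s', n', rfl, hs, hn, hf'⟩
    rw [Tm.code_inj] at hs
    rw [varCode_inj] at hn
    subst hs hn
    exact ⟨.or φ ψ, _, _, rfl, rfl, rfl, hf, hf'⟩

theorem freeForCode_node_and {x y t v : ℕ} :
    FreeForCode (node 6 [x, y]) t v ↔ FreeForCode x t v ∧ FreeForCode y t v := by
  constructor
  · rintro ⟨φ, s, n, h, hs, hn, hf⟩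
    obtain ⟨ψ, χ, rfl, rfl, rfl⟩ := φ.eq_of_code_and h
    exact ⟨⟨ψ, s, n, rfl, hs, hn, hf.1⟩, χ, s, n, rfl, hs, hn, hf.2⟩
  · rintro ⟨⟨φ, s, n, rfl, rfl, rfl, hf⟩, ψ, s', n', rfl, hs, hn, hf'⟩
    rw [Tm.code_inj] at hs
    rw [varCode_inj] at hn
    subst hs hn
    exact ⟨.and φ ψ, _, _, rfl, rfl, rfl, hf, hf'⟩

theorem freeForCode_node_all {x y t v : ℕ} (h : IsFmCode (node 7 [x, y])) (ht : IsTmCode t)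
    (hv : ∃ n, v = varCode n) :
    FreeForCode (node 7 [x, y]) t v ↔
      ¬ FreeCode (node 7 [x, y]) v ∨ (¬ FreeCode t x ∧ FreeForCode y t v) := by
  obtain ⟨φ, h⟩ := h
  obtain ⟨m, ψ, rfl, rfl, rfl⟩ := φ.eq_of_code_all h
  obtain ⟨t, rfl⟩ := ht
  obtain ⟨n, rfl⟩ := hv
  rw [← h, freeForCode_code, freeForCode_code, freeCode_fm_varCode, freeCode_tm_varCode]
  rfl

theorem freeForCode_node_ex {x y t v : ℕ} (h : IsFmCode (node 8 [x, y])) (ht : IsTmCode t)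
    (hv : ∃ n, v = varCode n) :
    FreeForCode (node 8 [x, y]) t v ↔
      ¬ FreeCode (node 8 [x, y]) v ∨ (¬ FreeCode t x ∧ FreeForCode y t v) := by
  obtain ⟨φ, h⟩ := h
  obtain ⟨m, ψ, rfl, rfl, rfl⟩ := φ.eq_of_code_ex h
  obtain ⟨t, rfl⟩ := ht
  obtain ⟨n, rfl⟩ := hv
  rw [← h, freeForCode_code, freeForCode_code, freeCode_fm_varCode, freeCode_tm_varCode]
  rfl

theorem models_ffAx (X : Set ℕ) : ∀ φ ∈ ffAx, Models X φ := by
  simp only [ffAx, List.forall_mem_append, List.forall_mem_cons, List.forall_mem_map,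
    List.not_mem_nil, false_imp_iff, implies_true, and_true]
  refine ⟨⟨models_alls _ fun e => ?_, models_alls _ fun e => ?_, models_alls _ fun e => ?_,
    models_alls _ fun e => ?_, models_alls _ fun e => ?_, models_alls _ fun e => ?_,
    models_alls _ fun e => ?_⟩, models_alls _ fun e => ?_, models_alls _ fun e => ?_⟩
  · simp [Fm.Sat]
    tauto
  · simp [Fm.Sat, Fm.sat_imp]
    rintro ⟨φ, t, n, hφ, ht, hn, -⟩
    exact ⟨⟨φ, hφ⟩, ⟨t, ht⟩, n, hn.symm⟩
  · simp [Fm.Sat, Fm.sat_imp]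
    rintro ⟨φ, hφ⟩ ⟨t, ht⟩ n hn
    obtain ⟨r, s, rfl, -, -⟩ := φ.eq_of_code_eq hφ
    exact ⟨_, t, n, hφ, ht, hn.symm, trivial⟩
  · simp [Fm.Sat, Fm.sat_imp]
    rintro ⟨φ, hφ⟩ ⟨t, ht⟩ n hn
    obtain ⟨s, rfl, -⟩ := φ.eq_of_code_tr hφ
    exact ⟨_, t, n, hφ, ht, hn.symm, trivial⟩
  · simp [Fm.sat_iff, freeForCode_node_neg]
  · simp [Fm.sat_iff, Fm.Sat, freeForCode_node_or]
  · simp [Fm.sat_iff, Fm.Sat, freeForCode_node_and]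
  · simp [Fm.sat_imp, Fm.sat_iff, Fm.Sat]
    exact fun h ht n hn => freeForCode_node_all h ht ⟨n, hn⟩
  · simp [Fm.sat_imp, Fm.sat_iff, Fm.Sat]
    exact fun h ht n hn => freeForCode_node_ex h ht ⟨n, hn⟩

theorem models_finAx (X : Set ℕ) : ∀ φ ∈ finAx, Models X φ := by
  simp only [finAx, List.forall_mem_append]
  exact ⟨⟨⟨⟨⟨⟨models_arithAx X, models_basicDefAx X⟩, models_tmAx X⟩, models_fmAx X⟩,
    models_fvAx X⟩, models_subAx X⟩, models_ffAx X⟩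

theorem models_PAT (X : Set ℕ) : ∀ φ ∈ PAT, Models X φ := by
  rintro φ (h | ⟨-, vs, n, ψ, rfl⟩)
  · exact models_finAx X φ h
  · exact models_alls vs (indF_models n ψ)

/-! ### Evaluation of closed terms -/

/-- Every pair in the list `L` arises from pairs in `L` by one of the evaluation clauses. -/
def IsEvalList (L : List ℕ) : Prop :=
  ∀ p ∈ L, ∃ (k : ℕ) (f : Fn k) (a b : Fin k → ℕ),
    p = Nat.pair (node f.tag (List.ofFn a)) (f.interp b) ∧ ∀ i, Nat.pair (a i) (b i) ∈ L

/-- An evaluation list assigns no wrong value: the clause that produces a pair is determined by the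
code of the term. -/
theorem IsEvalList.val_eq {L : List ℕ} (hL : IsEvalList L) {t : Tm} {v : ℕ}
    (h : Nat.pair t.code v ∈ L) (e : ℕ → ℕ) : t.val e = v := by
  induction t generalizing v with
  | var n =>
    obtain ⟨k, f, a, b, hp, -⟩ := hL _ h
    exact (varCode_ne_node_tag f n _ (Nat.pair_eq_pair.1 hp).1).elim
  | app g us ih =>
    obtain ⟨k, f, a, b, hp, hab⟩ := hL _ h
    obtain ⟨hc, rfl⟩ := Nat.pair_eq_pair.1 hp
    obtain ⟨ts, ht, hts⟩ := Tm.eq_app_of_code hc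
    cases ht
    simp only [Tm.val]
    exact congrArg _ (funext fun i => ih i (by rw [hts]; exact hab i))

/-- The pairs for all subterms of a closed term form an evaluation list. -/
theorem exists_isEvalList {t : Tm} (ht : t.Closed) (e : ℕ → ℕ) :
    ∃ L, IsEvalList L ∧ Nat.pair t.code (t.val e) ∈ L := by
  induction t with
  | var n => exact (ht n rfl).elim
  | @app k f ts ih =>
    choose L hL hmem using fun i => ih i fun n hn => ht n ⟨i, hn⟩
    have sub (i : Fin k) : ∀ p ∈ L i, p ∈ (List.ofFn L).flatten :=
      fun p hp => List.mem_flatten.2 ⟨_, List.mem_ofFn.2 ⟨i, rfl⟩, hp⟩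
    refine ⟨Nat.pair (Tm.app f ts).code ((Tm.app f ts).val e) :: (List.ofFn L).flatten, ?_,
      List.mem_cons_self⟩
    intro p hp
    rcases List.mem_cons.1 hp with rfl | hp
    · exact ⟨k, f, _, _, rfl, fun i => List.mem_cons_of_mem _ (sub i _ (hmem i))⟩
    · obtain ⟨l, hl, hp⟩ := List.mem_flatten.1 hp
      obtain ⟨i, rfl⟩ := List.mem_ofFn.1 hl
      obtain ⟨k', g, a, b, h, hab⟩ := hL i p hp
      exact ⟨k', g, a, b, h, fun j => List.mem_cons_of_mem _ (sub i _ (hab j))⟩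

/-- The part of `valF` for the function symbol `f`. -/
theorem sat_evalClause {X : Set ℕ} {e : ℕ → ℕ} {k : ℕ} (f : Fn k) :
    (Fm.exs ((List.range k).map (60 + ·)) (Fm.exs ((List.range k).map (70 + ·))
      ((Fm.eq (V 81) (prT (nodeT f.tag (List.ofFn fun i : Fin k => V (60 + i)))
          (.app f fun i => V (70 + i)))).and
        (conjF (List.ofFn fun i : Fin k =>
          Fm.eq (memT (prT (V (60 + i)) (V (70 + i))) (V 80)) oneT))))).Sat X e ↔
    ∃ a b : Fin k → ℕ, e 81 = Nat.pair (node f.tag (List.ofFn a)) (f.interp b) ∧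
      ∀ i, Nat.pair (a i) (b i) ∈ Denumerable.ofNat (List ℕ) (e 80) := by
  have hk := f.arity_le
  have val (a b : ℕ → ℕ) :
      ((Fm.eq (V 81) (prT (nodeT f.tag (List.ofFn fun i : Fin k => V (60 + i)))
          (.app f fun i => V (70 + i)))).and
        (conjF (List.ofFn fun i : Fin k =>
          Fm.eq (memT (prT (V (60 + i)) (V (70 + i))) (V 80)) oneT))).Sat X
        (fun n => if 70 ≤ n ∧ n < 70 + k then b n else
          if 60 ≤ n ∧ n < 60 + k then a n else e n) ↔
      e 81 = Nat.pair (node f.tag (List.ofFn fun i : Fin k => a (60 + i)))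
          (f.interp fun i : Fin k => b (70 + i)) ∧
        ∀ i : Fin k, Nat.pair (a (60 + i)) (b (70 + i)) ∈ Denumerable.ofNat (List ℕ) (e 80) := by
    have h₁ (i : Fin k) : ¬ (70 ≤ 60 + (i : ℕ) ∧ 60 + (i : ℕ) < 70 + k) := by omega
    have h₂ : ¬ (70 ≤ 80 ∧ 80 < 70 + k) := by omega
    have h₃ : ¬ (60 ≤ 80 ∧ 80 < 60 + k) := by omega
    have h₄ : ¬ (70 ≤ 81 ∧ 81 < 70 + k) := by omega
    have h₅ : ¬ (60 ≤ 81 ∧ 81 < 60 + k) := by omega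
    simp only [Fm.Sat, sat_conjF, List.forall_mem_ofFn_iff, val_prT, val_nodeT, val_memT, val_V,
      val_oneT, charVal_eq_one, List.map_ofFn, Function.comp_def, Tm.val, if_neg (h₁ _), if_neg h₂,
      if_neg h₃, if_neg h₄, if_neg h₅]
    simp
  rw [sat_exs_range]
  simp only [sat_exs_range, val]
  constructor
  · rintro ⟨a, b, h⟩
    exact ⟨_, _, h⟩
  · rintro ⟨a, b, h⟩
    refine ⟨fun n => if h : n - 60 < k then a ⟨n - 60, h⟩ else 0,
      fun n => if h : n - 70 < k then b ⟨n - 70, h⟩ else 0, ?_⟩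
    simpa using h

theorem sat_valF {X : Set ℕ} {e : ℕ → ℕ} {t v : Tm} (ht : ¬ t.Occ 80) (hv : ¬ v.Occ 80) :
    (valF t v).Sat X e ↔ ∃ L, Nat.pair (t.val e) (v.val e) ∈ L ∧ IsEvalList L := by
  have surj : Function.Surjective (Denumerable.ofNat (List ℕ)) :=
    fun L => ⟨Encodable.encode L, Denumerable.ofNat_encode L⟩
  rw [surj.exists]
  simp only [valF, Fm.Sat, Fm.sat_imp, sat_disjF, List.mem_map, exists_exists_and_eq_and,
    sat_evalClause, val_memT, val_prT, val_V, val_oneT, charVal_eq_one, val_update_of_not_occ ht,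
    val_update_of_not_occ hv, IsEvalList]
  refine exists_congr fun n => and_congr (by simp) (forall_congr' fun p => imp_congr (by simp) ?_)
  simp only [Function.update_self, ne_eq, Nat.reduceEqDiff, not_false_eq_true,
    Function.update_of_ne]
  constructor
  · rintro ⟨⟨k, f⟩, -, h⟩
    exact ⟨k, f, h⟩
  · rintro ⟨k, f, h⟩
    exact ⟨⟨k, f⟩, f.mem_all, h⟩

theorem sat_sameValF {X : Set ℕ} {e : ℕ → ℕ} {m n : ℕ} {s t : Tm} (hm : m < 60) (hn : n < 60)
    (hs : s.Closed) (ht : t.Closed) (hsm : s.code = e m) (htn : t.code = e n) :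
    (sameValF (V m) (V n)).Sat X e ↔ s.val e = t.val e := by
  have h₁ : ¬ (V m).Occ 80 := by simp; omega
  have h₂ : ¬ (V n).Occ 80 := by simp; omega
  have h₃ : ¬ (V 85).Occ 80 := by simp
  have h₄ : m ≠ 85 := by omega
  have h₅ : n ≠ 85 := by omega
  simp only [sameValF, Fm.Sat, sat_valF h₁ h₃, sat_valF h₂ h₃, val_V, Function.update_self,
    Function.update_of_ne h₄, Function.update_of_ne h₅, ← hsm, ← htn]
  constructor
  · rintro ⟨v, ⟨L, hs, hL⟩, L', ht, hL'⟩
    rw [hL.val_eq hs, hL'.val_eq ht]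
  · intro h
    obtain ⟨L, hL, hs⟩ := exists_isEvalList hs e
    obtain ⟨L', hL', ht⟩ := exists_isEvalList ht e
    exact ⟨t.val e, ⟨L, h ▸ hs, hL⟩, L', ht, hL'⟩

/-! ### The formula `Ax_PAT` -/

/-- If prefixing a list of numbers to `y` yields a formula, then the numbers code variables and `y`
codes a formula. -/
theorem exists_alls_of_isFmCode_gen {l : List ℕ} {y : ℕ}
    (h : IsFmCode (l.foldr (fun v x => node 7 [v, x]) y)) :
    ∃ vs ψ, ψ.code = y ∧ (Fm.alls vs ψ).code = l.foldr (fun v x => node 7 [v, x]) y := by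
  induction l with
  | nil =>
    obtain ⟨ψ, hψ⟩ := h
    exact ⟨[], ψ, hψ, hψ⟩
  | cons v l ih =>
    obtain ⟨⟨n, hn⟩, h⟩ := isFmCode_node_all.1 h
    obtain ⟨vs, ψ, hψ, hvs⟩ := ih h
    refine ⟨n :: vs, ψ, hψ, ?_⟩
    rw [List.foldr_cons, ← hvs, hn]
    rfl

theorem exists_of_sat_logAxF {X : Set ℕ} {e : ℕ → ℕ} (h : (logAxF (V 21)).Sat X e) :
    ∃ ψ, LogAx ψ ∧ ψ.code = e 21 := by
  simp only [logAxF, sat_disjF, List.exists_mem_cons_iff, Fm.exs, List.foldr_cons, List.foldr_nil,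
    Fm.Sat, sat_conjF, List.forall_mem_cons, List.not_mem_nil, false_imp_iff, implies_true,
    and_true, false_and, exists_false, or_false, sat_isFmF, sat_isTmF, sat_freeF, sat_freeForF,
    sat_isVarF, occ_V, val_V, val_dImpT, val_dNegT, val_dOrT, val_dAndT, val_dAllT, val_dExT,
    val_dEqT, val_subT, Function.update_self, ne_eq, not_false_eq_true, Function.update_of_ne,
    Nat.reduceEqDiff] at h
  rcases h with ⟨_, _, ⟨⟨a, rfl⟩, b, rfl⟩, h⟩ | ⟨_, _, _, ⟨⟨a, rfl⟩, ⟨b, rfl⟩, c, rfl⟩, h⟩ |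
    ⟨_, _, ⟨⟨a, rfl⟩, b, rfl⟩, h⟩ | ⟨_, _, ⟨⟨a, rfl⟩, b, rfl⟩, h⟩ | ⟨_, _, ⟨⟨a, rfl⟩, b, rfl⟩, h⟩ |
    ⟨_, _, _, ⟨⟨a, rfl⟩, ⟨b, rfl⟩, c, rfl⟩, h⟩ | ⟨_, _, ⟨⟨a, rfl⟩, b, rfl⟩, h⟩ |
    ⟨_, _, ⟨⟨a, rfl⟩, b, rfl⟩, h⟩ | ⟨_, _, ⟨⟨a, rfl⟩, b, rfl⟩, h⟩ |
    ⟨_, _, _, ⟨⟨a, rfl⟩, ⟨b, rfl⟩, n, rfl⟩, h⟩ | ⟨_, _, ⟨⟨a, rfl⟩, ⟨n, rfl⟩, hf⟩, h⟩ |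
    ⟨_, _, _, ⟨a, t, n, rfl, rfl, rfl, hf⟩, h⟩ | ⟨_, _, _, ⟨a, t, n, rfl, rfl, rfl, hf⟩, h⟩ |
    ⟨_, _, _, ⟨⟨a, rfl⟩, ⟨b, rfl⟩, ⟨n, rfl⟩, hf⟩, h⟩ | ⟨_, ⟨t, rfl⟩, h⟩ |
    ⟨_, _, _, _, ⟨⟨a, t, n, rfl, rfl, rfl, hf⟩, b, s, m, hb, rfl, hm, hf'⟩, h⟩ <;>
    rw [h]
  · exact ⟨_, .k a b, rfl⟩
  · exact ⟨_, .s a b c, rfl⟩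
  · exact ⟨_, .contra a b, rfl⟩
  · exact ⟨_, .orLeft a b, rfl⟩
  · exact ⟨_, .orRight a b, rfl⟩
  · exact ⟨_, .orElim a b c, rfl⟩
  · exact ⟨_, .andLeft a b, rfl⟩
  · exact ⟨_, .andRight a b, rfl⟩
  · exact ⟨_, .andIntro a b, rfl⟩
  · exact ⟨_, .allDist n a b, rfl⟩
  · exact ⟨_, .allVac n a (mt freeCode_fm_varCode.2 hf), rfl⟩
  · rw [subCode_fm]
    exact ⟨_, .allInst n a t hf, rfl⟩
  · rw [subCode_fm]
    exact ⟨_, .exIntro n a t hf, rfl⟩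
  · exact ⟨_, .exElim n a b (mt freeCode_fm_varCode.2 hf), rfl⟩
  · exact ⟨_, .eqRefl t, rfl⟩
  · cases Fm.code_injective hb
    cases varCode_inj.1 hm
    rw [subCode_fm, subCode_fm]
    exact ⟨_, .eqSubst n a t s hf hf', rfl⟩

theorem exists_of_sat_indAxF {X : Set ℕ} {e : ℕ → ℕ} (h : (indAxF (V 21)).Sat X e) :
    ∃ n ψ, (indF n ψ).code = e 21 := by
  simp only [indAxF, Fm.exs, List.foldr_cons, List.foldr_nil, Fm.Sat, sat_conjF,
    List.forall_mem_cons, List.not_mem_nil, false_imp_iff, implies_true, and_true, sat_isFmF,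
    sat_isVarF, occ_V, val_V, val_dImpT, val_dAndT, val_dAllT, val_subT, val_numeral, val_nodeT,
    List.map_cons, List.map_nil, Function.update_self, ne_eq, not_false_eq_true,
    Function.update_of_ne, Nat.reduceEqDiff] at h
  obtain ⟨_, _, ⟨⟨ψ, rfl⟩, n, rfl⟩, h⟩ := h
  have hS : node (Fn.tag .succ) [varCode n] = (succT (V n)).code := rfl
  rw [hS, subCode_fm, subCode_fm] at h
  exact ⟨n, ψ, h.symm⟩

/-- Every number that satisfies `Ax_PAT` codes a sentence that holds in every `(ℕ, Y)`. -/
theorem exists_of_sat_AxPATF {X : Set ℕ} {e : ℕ → ℕ} (h : (AxPATF (V 0)).Sat X e) :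
    ∃ φ : Fm, φ.IsSentence ∧ φ.code = e 0 ∧ ∀ Y, Models Y φ := by
  simp only [AxPATF, Fm.Sat, sat_disjF, List.mem_map, exists_exists_and_eq_and, Fm.exs,
    List.foldr_cons, List.foldr_nil, val_V, val_quoteT, val_genT] at h
  rcases h with ⟨φ, hφ, h⟩ | ⟨hs, l, y, h, hy⟩
  · exact ⟨φ, isSentence_of_mem_finAx hφ, h.symm, fun Y => models_finAx Y φ hφ⟩
  · rw [sat_SentF (by simp)] at hs
    obtain ⟨φ, hφ, hs⟩ := hs
    simp only [Function.update_self, ne_eq, OfNat.zero_ne_ofNat, not_false_eq_true,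
      Function.update_of_ne, Nat.reduceEqDiff] at h
    rw [val_V] at hs
    obtain ⟨vs, ψ, hψ, hvs⟩ := exists_alls_of_isFmCode_gen ⟨φ, hs.trans h⟩
    have hφψ : φ = Fm.alls vs ψ := Fm.code_injective (hs.trans (h.trans hvs.symm))
    refine ⟨φ, hφ, hs, fun Y => hφψ ▸ models_alls vs ?_⟩
    rcases hy with hy | hy
    · obtain ⟨χ, hχ, hc⟩ := exists_of_sat_logAxF hy
      rw [Function.update_self, ← hψ, Fm.code_inj] at hc
      exact hc ▸ hχ.models
    · obtain ⟨n, χ, hc⟩ := exists_of_sat_indAxF hy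
      rw [Function.update_self, ← hψ, Fm.code_inj] at hc
      exact hc ▸ indF_models n χ

/-! ### Fixed points of the jump -/

theorem code_mem_jumpMC {S : Set ℕ} {φ : Fm} (hφ : φ.IsSentence) :
    φ.code ∈ jumpMC S ↔ SatMC S φ :=
  ⟨fun ⟨_, _, h, hs⟩ => Fm.code_injective h ▸ hs, fun h => ⟨φ, hφ, rfl, h⟩⟩

theorem jumpMC_subset_sentCodes (S : Set ℕ) : jumpMC S ⊆ sentCodes :=
  fun _ ⟨φ, hφ, h, _⟩ => ⟨φ, hφ, h⟩

theorem jumpMC_mono {S T : Set ℕ} (h : S ⊆ T) : jumpMC S ⊆ jumpMC T :=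
  fun _ ⟨φ, hφ, hc, hs⟩ => ⟨φ, hφ, hc, fun X' hX' => hs X' (h.trans hX')⟩

/-- All members of the jump of `S` hold in `(ℕ, S')`, for any maximally consistent `S' ⊇ S`. -/
theorem consistent_jumpMC {S : Set ℕ} (hS : S ⊆ sentCodes) (h : Consistent (theoryOf S)) :
    Consistent (theoryOf (jumpMC S)) := by
  obtain ⟨S', hSS', hS'⟩ := exists_MCX_superset hS h
  exact consistent_of_models (X := S') fun φ hφ => (code_mem_jumpMC hφ.1).1 hφ.2 S' hSS' hS'

/-- A maximal consistent set among those with `S ⊆ jumpMC S` is a fixed point, as the jump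
preserves both properties. -/
theorem exists_consistent_fixedPoint :
    ∃ X : Set ℕ, Consistent (theoryOf X) ∧ X = jumpMC X := by
  have h₀ : Consistent (theoryOf ∅) := consistent_of_models (X := ∅) fun φ hφ => hφ.2.elim
  obtain ⟨M, -, hM⟩ := zorn_subset_nonempty
    {Y : Set ℕ | Consistent (theoryOf Y) ∧ Y ⊆ jumpMC Y}
    (fun c hc hch hne => ⟨⋃₀ c,
      ⟨consistent_theoryOf_sUnion hch hne fun Y hY => (hc hY).1,
        Set.sUnion_subset fun Y hY =>
          (hc hY).2.trans (jumpMC_mono (Set.subset_sUnion_of_mem hY))⟩,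
      fun Y hY => Set.subset_sUnion_of_mem hY⟩) ∅ ⟨h₀, Set.empty_subset _⟩
  have hc := consistent_jumpMC (hM.prop.2.trans (jumpMC_subset_sentCodes M)) hM.prop.1
  exact ⟨M, hM.prop.1, hM.prop.2.antisymm
    (hM.le_of_ge ⟨hc, jumpMC_mono hM.prop.2⟩ hM.prop.2)⟩

theorem inter_antiext_eq_empty {X : Set ℕ} (h : Consistent (theoryOf X)) : X ∩ antiext X = ∅ := by
  refine Set.eq_empty_of_forall_notMem ?_
  rintro _ ⟨hx, φ, hφ, rfl, hn⟩
  exact h ⟨φ, .hyp ⟨hφ, hx⟩, .hyp ⟨hφ, hn⟩⟩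

/-- If `X` had no maximally consistent extension, its jump would contain every sentence. -/
theorem exists_MCX_of_inter_antiext {X : Set ℕ} (hcons : X ∩ antiext X = ∅) (hX : X = jumpMC X) :
    ∃ X', X ⊆ X' ∧ MCX X' := by
  by_contra hne
  have all {φ : Fm} (hφ : φ.IsSentence) : φ.code ∈ X := by
    rw [hX, code_mem_jumpMC hφ]
    exact fun X' h₁ h₂ => (hne ⟨X', h₁, h₂⟩).elim
  have ht : topF.IsSentence := fun n hn => hn.elim (closed_numeral 0 n) (closed_numeral 0 n)
  have : topF.code ∈ X ∩ antiext X := ⟨all ht, topF, ht, rfl, all (φ := topF.neg) ht⟩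
  simp [hcons] at this

section FixedPoint

variable {X : Set ℕ}

theorem code_mem_iff (hX : X = jumpMC X) {φ : Fm} (hφ : φ.IsSentence) :
    φ.code ∈ X ↔ ∀ X', X ⊆ X' → MCX X' → Models X' φ := by
  conv_lhs => rw [hX]
  exact code_mem_jumpMC hφ

theorem subset_sentCodes (hX : X = jumpMC X) : X ⊆ sentCodes := by
  rw [hX]
  exact jumpMC_subset_sentCodes X

/-- A fixed point is closed under derivability. -/
theorem code_mem_of_proves (hX : X = jumpMC X) {φ : Fm} (hφ : φ.IsSentence)
    (h : Proves (theoryOf X) φ) : φ.code ∈ X :=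
  (code_mem_iff hX hφ).2 fun X' h₁ h₂ =>
    h.models fun _ hψ => (code_mem_iff hX hψ.1).1 hψ.2 X' h₁ h₂

/-- A fixed point is the intersection of its maximally consistent extensions. -/
theorem code_mem_iff_forall_mem (hX : X = jumpMC X) {φ : Fm} (hφ : φ.IsSentence) :
    φ.code ∈ X ↔ ∀ X', X ⊆ X' → MCX X' → φ.code ∈ X' := by
  refine ⟨fun h X' h₁ _ => h₁ h, fun h => code_mem_of_proves hX hφ ?_⟩
  refine Proves.of_not_consistent_insert_neg fun hc => ?_
  have hn : φ.neg.IsSentence := hφ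
  rw [← theoryOf_insert hn] at hc
  obtain ⟨X', h₁, h₂⟩ := exists_MCX_superset
    (Set.insert_subset (code_mem_sentCodes.2 hn) (subset_sentCodes hX)) hc
  exact (h₂.neg_mem_iff hφ).1 (h₁ (Set.mem_insert _ _))
    (h X' ((Set.subset_insert _ _).trans h₁) h₂)

theorem isSentence_subst_numeral {φ : Fm} {n : ℕ} (h : ∀ m, φ.Free m → m = n) (k : ℕ) :
    (φ.subst n (numeral k)).IsSentence := fun m hm => by
  rw [Fm.free_subst_of_closed (closed_numeral k)] at hm
  exact hm.2 (h m hm.1)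

theorem sat_subst_numeral (n k : ℕ) (φ : Fm) (e : ℕ → ℕ) :
    (φ.subst n (numeral k)).Sat X e ↔ φ.Sat X (Function.update e n k) := by
  rw [Fm.sat_subst (Fm.freeFor_of_closed (closed_numeral k) n φ), val_numeral]

/-- `⌜φ(k̇)⌝` belongs to a fixed point if and only if all its maximally consistent extensions
satisfy `φ` at `k`. -/
theorem subst_numeral_code_mem_iff (hX : X = jumpMC X) {φ : Fm} (h : ∀ m, φ.Free m → m = 0)
    (k : ℕ) (e : ℕ → ℕ) :
    (φ.subst 0 (numeral k)).code ∈ X ↔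
      ∀ X', X ⊆ X' → MCX X' → φ.Sat X' (Function.update e 0 k) := by
  have hs := isSentence_subst_numeral h k
  simp only [code_mem_iff hX hs, hs.models_iff e, sat_subst_numeral]

/-! ### The axioms of VFM in a fixed point -/

theorem models_VF1 (hX : X = jumpMC X) (hne : ∃ X', X ⊆ X' ∧ MCX X') : Models X VF1 := by
  refine models_alls _ fun e => ?_
  rw [Fm.sat_imp]
  simp only [Fm.Sat, Fm.sat_iff]
  rw [sat_CTF (by simp), sat_CTF (by simp)]
  rintro ⟨⟨s, hs, hsc⟩, t, ht, htc⟩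
  rw [sat_sameValF (by norm_num) (by norm_num) hsc htc hs ht]
  simp only [val_V] at hs ht
  simp only [val_dNegT, val_dEqT, val_V, ← hs, ← ht]
  have hst : (Fm.eq s t).IsSentence := fun n hn => hn.elim (hsc n) (htc n)
  obtain ⟨X', h₁, h₂⟩ := hne
  constructor
  · change (Fm.eq s t).code ∈ X ↔ _
    rw [code_mem_iff hX hst]
    simp only [hst.models_iff e]
    exact ⟨fun h => h X' h₁ h₂, fun h _ _ _ => h⟩
  · change (Fm.eq s t).neg.code ∈ X ↔ _
    have hst' : (Fm.eq s t).neg.IsSentence := hst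
    rw [code_mem_iff hX hst']
    simp only [hst'.models_iff e]
    exact ⟨fun h => h X' h₁ h₂, fun h _ _ _ => h⟩

theorem models_VF2 (hX : X = jumpMC X) : Models X VF2 := by
  refine models_all _ fun e => Fm.sat_imp.2 fun h => ?_
  obtain ⟨φ, hφ, hc, hm⟩ := exists_of_sat_AxPATF h
  simp only [Fm.Sat, val_V, ← hc]
  exact (code_mem_iff hX hφ).2 fun X' _ _ => hm X'

theorem models_VF3 (hX : X = jumpMC X) : Models X VF3 := by
  refine models_alls _ fun e => Fm.sat_imp.2 fun h => ?_
  simp only [Fm.Sat, val_subT, val_numT, val_dAllT, val_V, Function.update_self, ne_eq,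
    OfNat.zero_ne_ofNat, OfNat.one_ne_ofNat, not_false_eq_true, Function.update_of_ne] at h ⊢
  -- As `X` contains codes of sentences only, the instances are results of real substitutions.
  have hne (m : ℕ) : subCode (e 0) (numeral m).code (e 1) ≠ 0 := fun h0 => by
    obtain ⟨φ, -, hφ⟩ := subset_sentCodes hX (h m)
    exact φ.code_ne_zero (hφ.trans h0)
  obtain ⟨⟨t, ht⟩ | ⟨φ, hφ⟩, -, n, hn⟩ := of_subCode_ne_zero (hne 0)
  · -- A term remains a term under substitution, so its instances are not in `X`.
    obtain ⟨ψ, -, hψ⟩ := subset_sentCodes hX (h 0)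
    rw [← ht, hn, subCode_tm] at hψ
    exact (Tm.code_ne_code _ _ hψ.symm).elim
  · simp only [← hφ, hn, subCode_fm] at h ⊢
    change (Fm.all n φ).code ∈ X
    have hs (m : ℕ) : (φ.subst n (numeral m)).IsSentence :=
      code_mem_sentCodes.1 (subset_sentCodes hX (h m))
    have hall : (Fm.all n φ).IsSentence := fun k hk =>
      hs 0 k ((Fm.free_subst_of_closed (closed_numeral 0) n k φ).2 ⟨hk.2, Ne.symm hk.1⟩)
    refine (code_mem_iff hX hall).2 fun X' h₁ h₂ e' m => ?_
    exact (sat_subst_numeral n m φ e').1 ((code_mem_iff hX (hs m)).1 (h m) X' h₁ h₂ e')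

theorem free_tr_V {m n : ℕ} (h : (Fm.tr (V n)).Free m) : m = n := by
  simpa [Fm.Free, eq_comm] using h

/-- A fixed point contains `Tr(k̄)` if and only if all its maximally consistent extensions contain
`k`; it is not assumed that `k` codes a sentence. -/
theorem dot_tr_code_mem_iff (hX : X = jumpMC X) (k : ℕ) :
    ((Fm.tr (V 0)).subst 0 (numeral k)).code ∈ X ↔ ∀ X', X ⊆ X' → MCX X' → k ∈ X' := by
  rw [subst_numeral_code_mem_iff hX (fun _ => free_tr_V) k fun _ => 0]
  simp [Fm.Sat]

theorem models_VF4 (hX : X = jumpMC X) (hne : ∃ X', X ⊆ X' ∧ MCX X') : Models X VF4 := by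
  refine models_all _ fun e => Fm.sat_iff.2 ?_
  simp only [Fm.Sat, val_dotT, val_V]
  rw [dot_tr_code_mem_iff hX]
  refine ⟨fun h X' h₁ _ => h₁ h, fun h => ?_⟩
  -- The extension `X'` contains only sentences, so `e 0` is the code of a sentence.
  obtain ⟨X', h₁, h₂⟩ := hne
  obtain ⟨φ, hφ, hc⟩ := h₂.1 (h X' h₁ h₂)
  rw [← hc] at h ⊢
  exact (code_mem_iff_forall_mem hX hφ).2 h

theorem models_VF4star (h : Models X VF4) : Models X VF4star :=
  fun e k => Fm.sat_imp.2 (Fm.sat_iff.1 (h e k)).1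

theorem models_VF5 (hX : X = jumpMC X) : Models X VF5 := by
  refine models_all _ fun e => Fm.sat_imp.2 fun h => Fm.sat_iff.2 ?_
  rw [sat_SentF (by simp)] at h
  obtain ⟨φ, hφ, hc⟩ := h
  rw [val_V] at hc
  simp only [Fm.Sat, val_dNegT, val_dotT, val_V, ← hc]
  change ((Fm.tr (V 0)).neg.subst 0 (numeral φ.code)).code ∈ X ↔ φ.neg.code ∈ X
  have hn : φ.neg.IsSentence := hφ
  rw [subst_numeral_code_mem_iff hX (φ := (Fm.tr (V 0)).neg) (fun _ => free_tr_V) _ e,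
    code_mem_iff_forall_mem hX hn]
  refine forall_congr' fun X' => imp_congr_right fun _ => imp_congr_right fun h₂ => ?_
  rw [h₂.neg_mem_iff hφ]
  simp [Fm.Sat]

theorem models_VF6 (hX : X = jumpMC X) : Models X VF6 := by
  refine models_alls _ fun e => Fm.sat_imp.2 fun h => Fm.sat_imp.2 fun h' => ?_
  simp only [Fm.Sat, val_dImpT, val_V] at h h' ⊢
  obtain ⟨χ, hχ, hc⟩ := subset_sentCodes hX h
  obtain ⟨φ', ψ, rfl, hφ', hψ⟩ := χ.eq_of_code_or hc
  obtain ⟨φ, rfl, hφ⟩ := φ'.eq_of_code_neg hφ'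
  rw [← hc] at h
  rw [← hφ] at h'
  rw [← hψ]
  have h₁ : φ.IsSentence := fun n hn => hχ n (.inl hn)
  have h₂ : ψ.IsSentence := fun n hn => hχ n (.inr hn)
  exact code_mem_of_proves hX h₂ (.mp (.hyp ⟨hχ, h⟩) (.hyp ⟨h₁, h'⟩))

theorem models_VF7 (hX : X = jumpMC X) : Models X VF7 := by
  refine models_all _ fun e => ?_
  simp only [Fm.Sat, val_dotT, val_V]
  rw [subst_numeral_code_mem_iff hX ?_ _ e]
  · intro X' h₁ h₂
    refine Fm.sat_imp.2 fun h => Fm.sat_iff.2 ?_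
    rw [sat_SentF (by simp)] at h
    obtain ⟨φ, hφ, hc⟩ := h
    simp only [val_V, Function.update_self] at hc
    simp only [Fm.Sat, val_dNegT, val_V, Function.update_self, ← hc]
    exact (h₂.neg_mem_iff hφ).symm
  · intro m hm
    rw [← Fm.mem_fvs] at hm
    revert m
    decide +kernel

theorem models_VF8 (hX : X = jumpMC X) : Models X VF8 := by
  refine models_all _ fun e => ?_
  simp only [Fm.Sat, val_dotT, val_V]
  rw [subst_numeral_code_mem_iff hX ?_ _ e]
  · intro X' h₁ h₂
    refine Fm.sat_imp.2 fun h => ?_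
    rw [sat_SentF (by simp)]
    exact h₂.1 h
  · intro m hm
    rw [← Fm.mem_fvs] at hm
    revert m
    decide +kernel

end FixedPoint

theorem models_VFM {X : Set ℕ} (hcons : X ∩ antiext X = ∅) (hX : X = jumpMC X) :
    ∀ φ ∈ VFM, Models X φ := by
  have hne := exists_MCX_of_inter_antiext hcons hX
  rintro φ (h | rfl | rfl | rfl | rfl | rfl | rfl | rfl | rfl)
  · exact models_PAT X φ h
  · exact models_VF1 hX hne
  · exact models_VF2 hX
  · exact models_VF3 hX
  · exact models_VF4 hX hne
  · exact models_VF5 hX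
  · exact models_VF6 hX
  · exact models_VF7 hX
  · exact models_VF8 hX

theorem models_VFMminus {X : Set ℕ} (h : ∀ φ ∈ VFM, Models X φ) :
    ∀ φ ∈ VFMminus, Models X φ := by
  have h' {φ : Fm} (hφ : φ ∈ ({VF1, VF2, VF3, VF4, VF5, VF6, VF7, VF8} : Set Fm)) :
      Models X φ := h φ (.inr hφ)
  rintro φ (hφ | rfl | rfl | rfl | rfl | rfl | rfl | rfl | rfl)
  · exact h φ (.inl hφ)
  · exact h' (.inl rfl)
  · exact h' (.inr (.inl rfl))
  · exact h' (.inr (.inr (.inl rfl)))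
  · exact models_VF4star (h' (.inr (.inr (.inr (.inl rfl)))))
  · exact h' (.inr (.inr (.inr (.inr (.inl rfl)))))
  · exact h' (.inr (.inr (.inr (.inr (.inr (.inl rfl))))))
  · exact h' (.inr (.inr (.inr (.inr (.inr (.inr (.inl rfl)))))))
  · exact h' (.inr (.inr (.inr (.inr (.inr (.inr (.inr rfl)))))))

end SupervalTruth

theorem mainTheorem8 :
    (∀ X : Set ℕ, X ∩ SupervalTruth.antiext X = ∅ → X = SupervalTruth.jumpMC X →
      ∀ φ ∈ SupervalTruth.VFM, SupervalTruth.Models X φ) ∧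
    SupervalTruth.Consistent SupervalTruth.VFM ∧
    SupervalTruth.Consistent SupervalTruth.VFMminus := by
  obtain ⟨X, hc, hX⟩ := SupervalTruth.exists_consistent_fixedPoint
  have h := SupervalTruth.models_VFM (SupervalTruth.inter_antiext_eq_empty hc) hX
  exact ⟨fun X h₁ h₂ => SupervalTruth.models_VFM h₁ h₂,
    SupervalTruth.consistent_of_models h,
    SupervalTruth.consistent_of_models (SupervalTruth.models_VFMminus h)⟩
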